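/- Let $X$ be a connected, non-compact $C^\infty$ Riemannian manifold (Hausdorff, second countable) with Riemannian volume $m$, let $\mathbb R_+=(0,\infty)$ and let $\lambda$ be Lebesgue measure on $\mathbb R_+$. Let $\rho:X\to[0,\infty]$ and $p:X\times\mathbb R_+\to[0,\infty]$ be measurable, with $\rho>0$ $m$-a.e., $p(x,s)>0$ for $m$-a.e. $x$ and $\lambda$-a.e. $s$, and $\int_K\rho\,dm<\infty$ for every compact $K\subset X$. Put $q(x,s)=\rho(x)p(x,s)$ and $\tilde\sigma(dx,ds)=q(x,s)\,\lambda(ds)\,m(dx)$, and suppose that $\tilde\sigma(K\times\mathbb R_+)<\infty$ for every compact $K\subset X$. The marked configuration space $\Omega_X^{\mathbb R_+}$ is the set of all $\omega\subset X\times\mathbb R_+$ whose distinct points have distinct $X$-components and whose projection to $X$ is locally finite. It carries the smallest $\sigma$-algebra for which all counting functions $N_B(\omega)=\#(\omega\cap B)$ are measurable, $B\subset X\times\mathbb R_+$ Borel with relatively compact projection to $X$. The marked Poisson measure $\pi_{\tilde\sigma}$ with Lévy measure $\tilde\sigma$ is the probability measure on $\Omega_X^{\mathbb R_+}$ such that,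 for every relatively compact open $\Lambda\subset X$, the image of $\pi_{\tilde\sigma}$ under $\omega\mapsto\omega\cap(\Lambda\times\mathbb R_+)$ is $$e^{-\tilde\sigma(\Lambda\times\mathbb R_+)}\sum_{n=0}^\infty\frac1{n!}\,\tilde\sigma_{\Lambda,n},$$ where $\tilde\sigma_{\Lambda,n}$ is the image of the $n$-fold product of $\tilde\sigma|_{\Lambda\times\mathbb R_+}$ under $(z_1,\dots,z_n)\mapsto\{z_1,\dots,z_n\}$ (defined for tuples with distinct $X$-components, i.e. almost everywhere). Let $\mathrm{Diff}_0(X)$ be the group of $C^\infty$ diffeomorphisms of $X$ that are the identity outside a compact set, let $\mathbb R_+^X$ be the group of $C^\infty$ maps $\theta:X\to\mathbb R_+$ that equal $1$ outside a compact set, and let $\mathfrak G$ be their semidirect product, with multiplication $(\psi_1,\theta_1)(\psi_2,\theta_2)=(\psi_1\circ\psi_2,\ \theta_1\,(\theta_2\circ\psi_1^{-1}))$. The group $\mathfrak G$ acts on $X\times\mathbb R_+$ by $g(x,s)=(\psi(x),\theta(\psi(x))s)$ for $g=(\psi,\theta)$, and on $\Omega_X^{\mathbb R_+}$ by $g(\omega)=\{g(x,s):(x,s)\in\omega\}$;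 $g^*\mu$ denotes the image of a measure $\mu$ under $g$. Put $$p_g^{\tilde\sigma}(x,s)=\frac{q(\psi^{-1}(x),\theta(x)^{-1}s)}{q(x,s)\,\theta(x)}\,J(x)$$ if $0<q(x,s)<\infty$ and $0<q(\psi^{-1}(x),\theta(x)^{-1}s)<\infty$, and $p_g^{\tilde\sigma}(x,s)=1$ otherwise, where $J(x)$ is the absolute value of the Jacobian determinant of $\psi^{-1}$ at $x$ with respect to $m$. **Proposition.** The measure $\pi_{\tilde\sigma}$ exists and is unique. For every $g\in\mathfrak G$: 1. $p_g^{\tilde\sigma}$ is the density of $g^*\tilde\sigma$ with respect to $\tilde\sigma$, i.e. $g^*\tilde\sigma=p_g^{\tilde\sigma}\,\tilde\sigma$; 2. $\omega\mapsto g(\omega)$ is measurable and $\pi_{\tilde\sigma}$ is quasiinvariant under it: $g^*\pi_{\tilde\sigma}$ and $\pi_{\tilde\sigma}$ are mutually absolutely continuous; 3. for every $\omega$ only finitely many points $(x,s)\in\omega$ satisfy $p_g^{\tilde\sigma}(x,s)\neq1$, and for $\pi_{\tilde\sigma}$-a.e. $\omega$ $$\frac{d(g^*\pi_{\tilde\sigma})}{d\pi_{\tilde\sigma}}(\omega)=\prod_{(x,s)\in\omega}p_g^{\tilde\sigma}(x,s).$$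 -/

import Mathlib

open MeasureTheory Set Manifold ContDiff

noncomputable section

namespace MarkedConf

/-! ### Marks and the underlying Riemannian manifold -/

/-- The space of marks `ℝ₊ = (0, ∞)`; with Mathlib's instances it is a multiplicative group. -/
abbrev Mark : Type := {s : ℝ // 0 < s}

/-- The restriction `λ` of Lebesgue measure to `ℝ₊`. -/
def markLebesgue : Measure Mark := (volume : Measure ℝ).comap Subtype.val

/-- The model space `ℝ^d`. -/
abbrev Eu (d : ℕ) : Type := EuclideanSpace ℝ (Fin d)

/-- A smooth Riemannian metric on a manifold `X` modelled on `ℝ^d`. -/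
abbrev RMetric (d : ℕ) (X : Type*) [TopologicalSpace X] [ChartedSpace (Eu d) X]
    [IsManifold (𝓡 d) ∞ X] : Type _ :=
  Bundle.ContMDiffRiemannianMetric (𝓡 d) ∞ (Eu d) (fun x : X => TangentSpace (𝓡 d) x)

section Volume

variable {d : ℕ} {X : Type*} [TopologicalSpace X] [ChartedSpace (Eu d) X]
  [IsManifold (𝓡 d) ∞ X]

/-- The `d`-dimensional volume `√ det (⟨v i, v j⟩_x)` of the parallelepiped spanned by the tangent
vectors `v 0, …, v (d-1)` at `x`. -/
def parVol (h : RMetric d X) (x : X) (v : Fin d → TangentSpace (𝓡 d) x) : ℝ :=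
  Real.sqrt (Matrix.det (Matrix.of fun i j : Fin d => h.inner x (v i) (v j)))

/-- The standard basis of `ℝ^d`. -/
def stdBasis {d : ℕ} (i : Fin d) : Eu d := EuclideanSpace.single i (1 : ℝ)

/-- `√ det g_ij` at the point with coordinates `y` in the chart `e`. -/
def chartDensity (h : RMetric d X) (e : OpenPartialHomeomorph X (Eu d)) (y : Eu d) : ℝ :=
  parVol h (e.symm y) (fun i => mfderiv (𝓡 d) (𝓡 d) e.symm y (stdBasis i))

variable [MeasurableSpace X]

/-- The measure `√ det g_ij dy` of the chart `e`, carried over to the domain of the chart and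
extended by zero to all of `X`. -/
def chartVolume (h : RMetric d X) (e : OpenPartialHomeomorph X (Eu d)) : Measure X :=
  ((volume.restrict e.target).withDensity
    (fun y => ENNReal.ofReal (chartDensity h e y))).map e.symm

/-- The Riemannian volume `m`. The measures `√ det g_ij dy` of two charts agree on the overlap of
their domains; the measure obtained by gluing them is the least measure that dominates all of
them. -/
def riemVolume (h : RMetric d X) : Measure X :=
  ⨆ e ∈ atlas (Eu d) X, chartVolume h e

/-- The absolute value of the Jacobian determinant of a map `φ : X → X` at `x` with respect to the
Riemannian volume: the factor by which the differential of `φ` multiplies volumes in the tangent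
space at `x` (computed on one basis of the tangent space, and independent of it). -/
def riemJacobian (h : RMetric d X) (φ : X → X) (x : X) : ℝ :=
  parVol h (φ x) (fun i => mfderiv (𝓡 d) (𝓡 d) φ x (stdBasis i)) /
    parVol h x (fun i => stdBasis i)

end Volume

/-! ### The transformation group -/

section Group

variable (d : ℕ) (X : Type*) [TopologicalSpace X] [ChartedSpace (Eu d) X]

/-- The group of diffeomorphisms of `X` that are the identity outside a compact set. -/
def Diff0 : Subgroup (Equiv.Perm X) where
  carrier := {ψ | ContMDiff (𝓡 d) (𝓡 d) ∞ ψ ∧ ContMDiff (𝓡 d) (𝓡 d) ∞ ψ.symm ∧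
    ∃ K : Set X, IsCompact K ∧ ∀ x ∉ K, ψ x = x}
  one_mem' := ⟨contMDiff_id, contMDiff_id, ∅, isCompact_empty, fun _ _ => rfl⟩
  mul_mem' := by
    rintro ψ φ ⟨h1, h2, K, hK, h3⟩ ⟨h1', h2', K', hK', h3'⟩
    refine ⟨h1.comp h1', h2'.comp h2, K ∪ K', hK.union hK', fun x hx => ?_⟩
    rw [mem_union, not_or] at hx
    rw [Equiv.Perm.mul_apply, h3' x hx.2, h3 x hx.1]
  inv_mem' := by
    rintro ψ ⟨h1, h2, K, hK, h3⟩
    refine ⟨h2, h1, K, hK, fun x hx => ?_⟩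
    rw [Equiv.Perm.inv_eq_iff_eq, h3 x hx]

/-- The group of smooth currents: the smooth maps `X → ℝ₊` that are one outside a compact set,
with pointwise multiplication. -/
def Currents : Subgroup (X → Mark) where
  carrier := {θ | ContMDiff (𝓡 d) 𝓘(ℝ, ℝ) ∞ (fun x => (θ x : ℝ)) ∧
    ∃ K : Set X, IsCompact K ∧ ∀ x ∉ K, θ x = 1}
  one_mem' := ⟨contMDiff_const, ∅, isCompact_empty, fun _ _ => rfl⟩
  mul_mem' := by
    rintro θ η ⟨h1, K, hK, h3⟩ ⟨h1', K', hK', h3'⟩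
    refine ⟨?_, K ∪ K', hK.union hK', fun x hx => ?_⟩
    · exact (contDiff_mul.contMDiff).comp (h1.prodMk_space h1')
    · rw [mem_union, not_or] at hx
      rw [Pi.mul_apply, h3' x hx.2, h3 x hx.1, one_mul]
  inv_mem' := by
    rintro θ ⟨h1, K, hK, h3⟩
    refine ⟨?_, K, hK, fun x hx => by rw [Pi.inv_apply, h3 x hx, inv_one]⟩
    intro x
    exact ContMDiffAt.comp (g := fun t : ℝ => t⁻¹) x
      ((contDiffAt_inv ℝ (θ x).2.ne').contMDiffAt) (h1 x)

variable {d X}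

/-- `θ ∘ ψ⁻¹` is a smooth current. -/
theorem comp_inv_mem (ψ : Diff0 d X) (θ : Currents d X) :
    (θ.1 ∘ ψ.1.symm) ∈ Currents d X := by
  obtain ⟨h1, h2, K, hK, h3⟩ := ψ.2
  obtain ⟨h1', K', hK', h3'⟩ := θ.2
  refine ⟨h1'.comp h2, K ∪ K', hK.union hK', fun x hx => ?_⟩
  rw [mem_union, not_or] at hx
  have : ψ.1.symm x = x := by rw [Equiv.symm_apply_eq, h3 x hx.1]
  rw [Function.comp_apply, this, h3' x hx.2]

/-- The action of `Diff0` on the currents by automorphisms, `α(ψ)θ = θ ∘ ψ⁻¹`. -/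
def currentAction : Diff0 d X →* MulAut (Currents d X) where
  toFun ψ :=
    { toFun := fun θ => ⟨θ.1 ∘ ψ.1.symm, comp_inv_mem ψ θ⟩
      invFun := fun θ => ⟨θ.1 ∘ ψ.1, comp_inv_mem ψ⁻¹ θ⟩
      left_inv := fun θ => by ext x; simp
      right_inv := fun θ => by ext x; simp
      map_mul' := fun θ η => rfl }
  map_one' := rfl
  map_mul' _ _ := rfl

variable (d X)

/-- The semidirect product of `Diff0` and the currents. An element `g` has the components
`g.right = ψ` and `g.left = θ`, and
`(ψ₁, θ₁) (ψ₂, θ₂) = (ψ₁ ∘ ψ₂, θ₁ * (θ₂ ∘ ψ₁⁻¹))`. -/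
def MarkGroup : Type _ := SemidirectProduct (Currents d X) (Diff0 d X) currentAction

instance : Group (MarkGroup d X) :=
  inferInstanceAs (Group (SemidirectProduct (Currents d X) (Diff0 d X) currentAction))

variable {d X}

/-- The diffeomorphism `ψ` of `g = (ψ, θ)`. -/
def MarkGroup.diffeo (g : MarkGroup d X) : Equiv.Perm X := (SemidirectProduct.right g).1

/-- The current `θ` of `g = (ψ, θ)`. -/
def MarkGroup.current (g : MarkGroup d X) : X → Mark := (SemidirectProduct.left g).1

/-- The action `g (x, s) = (ψ x, θ (ψ x) s)` on `X × ℝ₊`. -/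
instance : MulAction (MarkGroup d X) (X × Mark) where
  smul g z := (g.diffeo z.1, g.current (g.diffeo z.1) * z.2)
  one_smul z := Prod.ext rfl (one_mul z.2)
  mul_smul g g' z := by
    refine Prod.ext rfl ?_
    change (g.current (g.diffeo (g'.diffeo z.1)) *
      g'.current (g.diffeo.symm (g.diffeo (g'.diffeo z.1)))) * z.2 = _
    rw [Equiv.symm_apply_apply, mul_assoc]
    rfl

end Group

/-! ### Marked configurations -/

section Configurations

/-- The space `Γ_X` of locally finite subsets of `X`. -/
def Conf (X : Type*) [TopologicalSpace X] : Set (Set X) :=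
  {γ | ∀ K : Set X, IsCompact K → (γ ∩ K).Finite}

/-- The marked configuration space: subsets `ξ` of `X × ℝ₊` in which distinct points have distinct
`X`-components and whose projection to `X` is locally finite. -/
def MConf (X : Type*) [TopologicalSpace X] : Type _ :=
  {ξ : Set (X × Mark) // InjOn Prod.fst ξ ∧ Prod.fst '' ξ ∈ Conf X}

variable {X : Type*} [TopologicalSpace X]

theorem mem_of_subset {ξ ξ' : Set (X × Mark)} (h : ξ' ⊆ ξ)
    (hξ : InjOn Prod.fst ξ ∧ Prod.fst '' ξ ∈ Conf X) :
    InjOn Prod.fst ξ' ∧ Prod.fst '' ξ' ∈ Conf X :=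
  ⟨hξ.1.mono h, fun K hK => (hξ.2 K hK).subset (inter_subset_inter_left K (image_mono h))⟩

theorem mem_of_finite {ξ : Set (X × Mark)} (hf : ξ.Finite) (hi : InjOn Prod.fst ξ) :
    InjOn Prod.fst ξ ∧ Prod.fst '' ξ ∈ Conf X :=
  ⟨hi, fun _ _ => (hf.image _).subset inter_subset_left⟩

/-- The number `N_B(ξ)` of points of `ξ` in `B`. -/
def count (B : Set (X × Mark)) (ξ : MConf X) : ℕ := (ξ.1 ∩ B).ncard

/-- The σ-algebra on the marked configuration space: the smallest one for which the `N_B` are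
measurable, for the Borel sets `B` of `X × ℝ₊` whose projection to `X` is relatively compact. -/
instance [MeasurableSpace X] : MeasurableSpace (MConf X) :=
  ⨆ B ∈ {B : Set (X × Mark) | MeasurableSet B ∧ ∃ K : Set X, IsCompact K ∧ Prod.fst '' B ⊆ K},
    MeasurableSpace.comap (count B) ⊤

/-- The restriction `p_Λ(ξ) = ξ ∩ (Λ × ℝ₊)`. -/
def restr (Λ : Set X) (ξ : MConf X) : MConf X :=
  ⟨ξ.1 ∩ Λ ×ˢ univ, mem_of_subset inter_subset_left ξ.2⟩

/-- The tuples of points of `X × ℝ₊` whose `X`-components are pairwise distinct. -/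
def distinctTuples (X : Type*) (n : ℕ) : Set (Fin n → X × Mark) :=
  {z | Function.Injective fun i => (z i).1}

open Classical in
/-- The map `(z_1, …, z_n) ↦ {z_1, …, z_n}` on tuples with distinct `X`-components (the value on
other tuples plays no role). -/
def ofTuple (n : ℕ) (z : Fin n → X × Mark) : MConf X :=
  if hz : z ∈ distinctTuples X n then
    ⟨range z, mem_of_finite (finite_range z) (by
      rintro _ ⟨i, rfl⟩ _ ⟨j, rfl⟩ hij
      rw [hz hij])⟩
  else ⟨∅, mem_of_finite finite_empty (injOn_empty _)⟩

variable {d : ℕ} [ChartedSpace (Eu d) X]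

/-- The lifting `g(ξ) = {g(x, s) | (x, s) ∈ ξ}` of the action to marked configurations. -/
instance : MulAction (MarkGroup d X) (MConf X) where
  smul g ξ := ⟨(fun z => g • z) '' ξ.1, by
    obtain ⟨h1, h2, -⟩ := (SemidirectProduct.right g).2
    refine ⟨?_, fun K hK => ?_⟩
    · rintro _ ⟨z, hz, rfl⟩ _ ⟨w, hw, rfl⟩ hzw
      have : z.1 = w.1 := g.diffeo.injective hzw
      rw [ξ.2.1 hz hw this]
    · refine ((ξ.2.2 _ (hK.image h2.continuous)).image g.diffeo).subset ?_
      rintro _ ⟨⟨_, ⟨z, hz, rfl⟩, rfl⟩, hK'⟩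
      refine ⟨z.1, ⟨⟨z, hz, rfl⟩, _, hK', ?_⟩, rfl⟩
      exact g.diffeo.symm_apply_apply z.1⟩
  one_smul ξ := Subtype.ext (by
    change (fun z => (1 : MarkGroup d X) • z) '' ξ.1 = ξ.1
    simp)
  mul_smul g g' ξ := Subtype.ext (by
    change (fun z => (g * g') • z) '' ξ.1 = (fun z => g • z) '' ((fun z => g' • z) '' ξ.1)
    simp only [mul_smul, image_image])

end Configurations

/-! ### Poisson measures and densities -/

section Poisson

variable {X : Type*} [TopologicalSpace X] [MeasurableSpace X]

/-- The probability measure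
`π^Λ = exp (-τ(Λ × ℝ₊)) ∑ₙ (1 / n!) τ_{Λ,n}`, where `τ_{Λ,n}` is the image of the `n`-fold product
of the restriction of `τ` to `Λ × ℝ₊` (which does not charge the tuples with coinciding
`X`-components) under `(z_1, …, z_n) ↦ {z_1, …, z_n}`. -/
def localPoisson (τ : Measure (X × Mark)) (Λ : Set X) : Measure (MConf X) :=
  ENNReal.ofReal (Real.exp (-(τ (Λ ×ˢ univ)).toReal)) •
    Measure.sum fun n : ℕ => ((n.factorial : ENNReal)⁻¹ •
      (((Measure.pi fun _ : Fin n => τ.restrict (Λ ×ˢ univ)).restrict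
        (distinctTuples X n)).map (ofTuple n)))

/-- `π` is the marked Poisson measure with Lévy measure `τ`: a probability measure on the marked
configuration space whose image under `p_Λ` is `π^Λ`, for every relatively compact open `Λ`. -/
def IsMarkedPoisson (τ : Measure (X × Mark)) (π : Measure (MConf X)) : Prop :=
  IsProbabilityMeasure π ∧
    ∀ Λ : Set X, IsOpen Λ → IsCompact (closure Λ) → π.map (restr Λ) = localPoisson τ Λ

variable {d : ℕ} [ChartedSpace (Eu d) X] [IsManifold (𝓡 d) ∞ X]

/-- The function `q(x, s) = ρ(x) p(x, s)`. -/
def qFun (ρ : X → ENNReal) (p : X → Mark → ENNReal) (z : X × Mark) : ENNReal := ρ z.1 * p z.1 z.2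

/-- The measure `σ̃(dx, ds) = ρ(x) p(x, s) λ(ds) m(dx)`. -/
def levyMeasure (h : RMetric d X) (ρ : X → ENNReal) (p : X → Mark → ENNReal) :
    Measure (X × Mark) :=
  ((riemVolume h).prod markLebesgue).withDensity (qFun ρ p)

open Classical in
/-- The density `p_g^σ̃(x, s) = q(ψ⁻¹ x, θ(x)⁻¹ s) / (q(x, s) θ(x)) * J(x)`, if both values of `q`
lie in `(0, ∞)`, and `1` otherwise; here `J` is the density with respect to `m` of the image of `m`
under `ψ`, that is, the absolute Jacobian determinant of `ψ⁻¹`. -/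
def groupDensity (h : RMetric d X) (ρ : X → ENNReal) (p : X → Mark → ENNReal)
    (g : MarkGroup d X) (z : X × Mark) : ENNReal :=
  let w : X × Mark := (g.diffeo.symm z.1, (g.current z.1)⁻¹ * z.2)
  if (0 < qFun ρ p z ∧ qFun ρ p z < ⊤) ∧ (0 < qFun ρ p w ∧ qFun ρ p w < ⊤) then
    qFun ρ p w / (qFun ρ p z * ENNReal.ofReal (g.current z.1 : ℝ)) *
      ENNReal.ofReal (riemJacobian h g.diffeo.symm z.1)
  else 1

end Poisson

end MarkedConf

end

/-! The proof has a geometric half, about a single point of `X × ℝ₊`, and a probabilistic half,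
which transfers the result to configurations.

Geometry: in charts, `m` is `√det g_ij dy`, and the Gram determinant picks up a factor `det²` under
a linear change of frame. Hence the Euclidean change of variables formula gives both the agreement
of chart volumes on overlaps and the density of `ψ^* m` (`map_riemVolume`). Fubini and the scaling
of Lebesgue measure give the density `J/θ` for `m ⊗ λ` (`map_prod_markGroup_smul`). Inserting `q`,
which lies in `(0, ∞)` almost everywhere, yields the density of `g^* σ̃` (`map_levyMeasure`).

Probability: a law on configurations is determined by its void probabilities (`ext_of_voidSet`), and
for the marked Poisson measure these are `exp (-σ̃ B)` (`localPoisson_voidSet`). This gives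
uniqueness. For existence, cut `X` into countably many relatively compact layers, take independent
Poisson configurations on them and glue (`exists_isMarkedPoisson`): the void probabilities multiply.
Diffuseness, `σ̃({x} × ℝ₊) = 0`, makes coinciding `X`-components negligible. It holds because a
connected non-compact manifold has dimension at least one.

Quasiinvariance: `g` is the identity over the complement of a compact `K`. For `Λ ⊇ K` it permutes
`Λ × ℝ₊`, so in each term of `π^Λ` the `n`-fold product acquires the density `∏ p_g(z_i)`, a
function of the configuration alone (`map_smul_localPoisson`). Since `g` preserves the mass of `Λ ×
ℝ₊`, no exponential correction appears. Such `Λ` determine a law, so the identity holds globally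
(`IsMarkedPoisson.map_smul`). Strict positivity of `p_g` gives equivalence of the two measures. -/

namespace MarkedConf
noncomputable section

set_option linter.unusedSectionVars false

/-! ### Gram determinants and the Riemannian Jacobian. -/

section Jacobian

variable {d : ℕ} {X : Type*} [TopologicalSpace X] [ChartedSpace (Eu d) X]
  [IsManifold (𝓡 d) ∞ X]

/-- With `M` the matrix of `A` and `G` the Gram matrix of the frame `B`, the new Gram matrix is `Mᵀ
G M`, whose determinant is `(det M)² det G`. -/
theorem parVol_comp (h : RMetric d X) (x : X) (B : Eu d →L[ℝ] TangentSpace (𝓡 d) x)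
    (A : Eu d →L[ℝ] Eu d) :
    parVol h x (fun i => B (A (stdBasis i))) = |A.det| * parVol h x (fun i => B (stdBasis i)) := by
  set b := (EuclideanSpace.basisFun (Fin d) ℝ).toBasis with hb
  set M := LinearMap.toMatrix b b (A : Eu d →ₗ[ℝ] Eu d) with hM
  have hA : ∀ i, A (stdBasis i) = ∑ k, M k i • stdBasis k := by
    intro i
    have := b.sum_repr (A (stdBasis i))
    rw [← this]
    refine Finset.sum_congr rfl fun k _ => ?_
    simp [hM, hb, LinearMap.toMatrix_apply, stdBasis]
  have hdet : A.det = M.det := by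
    rw [hM, LinearMap.det_toMatrix]
  have hG : (Matrix.of fun i j : Fin d => h.inner x (B (A (stdBasis i))) (B (A (stdBasis j)))) =
      M.transpose * (Matrix.of fun i j : Fin d => h.inner x (B (stdBasis i)) (B (stdBasis j))) *
        M := by
    ext i j
    simp only [Matrix.of_apply, Matrix.mul_apply, Matrix.transpose_apply, hA, map_sum, map_smul,
      sum_apply, smul_apply, smul_eq_mul]
    refine Finset.sum_congr rfl fun k _ => ?_
    rw [Finset.sum_mul]
    rw [Finset.mul_sum]
    refine Finset.sum_congr rfl fun l _ => ?_
    ring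
  rw [parVol, hG, Matrix.det_mul, Matrix.det_mul, Matrix.det_transpose, hdet, parVol,
    mul_right_comm, ← sq,
    Real.sqrt_mul (sq_nonneg _), Real.sqrt_sq_eq_abs]

/-- For injective `B` the Gram matrix is positive definite: its quadratic form at `v` is the squared
length of `B (∑ v i e_i)`. -/
theorem parVol_pos (h : RMetric d X) (x : X) (B : Eu d →L[ℝ] TangentSpace (𝓡 d) x)
    (hB : Function.Injective B) : 0 < parVol h x (fun i => B (stdBasis i)) := by
  refine Real.sqrt_pos.2 (Matrix.PosDef.det_pos ?_)
  refine Matrix.PosDef.of_dotProduct_mulVec_pos ?_ fun v hv => ?_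
  · ext i j
    simp [h.symm x (B (stdBasis j)) (B (stdBasis i))]
  · have hw : B (∑ i, v i • stdBasis i) ≠ 0 := by
      intro h0
      rw [← map_zero B] at h0
      have h1 := hB h0
      refine hv (funext fun i => ?_)
      have := congrArg (fun u : Eu d => u i) h1
      simpa [stdBasis, Pi.single_apply] using this
    have := h.pos x _ hw
    refine this.trans_eq ?_
    rw [map_sum, map_sum]
    simp only [dotProduct, Matrix.mulVec, Matrix.of_apply, map_smul, star_trivial,
      sum_apply, smul_apply, smul_eq_mul, Finset.mul_sum, map_sum]
    rw [Finset.sum_comm]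
    refine Finset.sum_congr rfl fun k _ => Finset.sum_congr rfl fun l _ => ?_
    rw [h.symm]; ring

theorem parVol_stdBasis_pos (h : RMetric d X) (x : X) :
    0 < parVol h x (fun i => stdBasis i) :=
  parVol_pos h x (ContinuousLinearMap.id ℝ (Eu d)) Function.injective_id

/-- The defining quotient does not depend on the frame: passing from the standard basis to `B`
multiplies both volumes by `|det B|`. The determinant makes sense because each tangent space is by
definition the model space. -/
theorem riemJacobian_mul_parVol (h : RMetric d X) (φ : X → X) (x : X)
    (B : Eu d →L[ℝ] TangentSpace (𝓡 d) x) :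
    riemJacobian h φ x * parVol h x (fun i => B (stdBasis i)) =
      parVol h (φ x) (fun i => mfderiv (𝓡 d) (𝓡 d) φ x (B (stdBasis i))) := by
  have h1 := parVol_comp h x (ContinuousLinearMap.id ℝ (Eu d)) B
  have h2 := parVol_comp h (φ x) (mfderiv (𝓡 d) (𝓡 d) φ x) B
  have h0 := (parVol_stdBasis_pos h x).ne'
  change parVol h x (fun i => B (stdBasis i)) = |B.det| * parVol h x (fun i => stdBasis i) at h1
  refine Eq.trans ?_ h2.symm
  rw [riemJacobian, h1]
  field_simp
  exact mul_comm _ _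

/-- The coordinate vector fields are continuous into the tangent bundle, being restrictions of the
tangent map of `e.symm`. Pairing them by the continuous metric gives continuous `g_ij`. -/
theorem continuousOn_chartDensity (h : RMetric d X) {e : OpenPartialHomeomorph X (Eu d)}
    (he : e ∈ atlas (Eu d) X) : ContinuousOn (chartDensity h e) e.target := by
  have hs : ContMDiffOn (𝓡 d) (𝓡 d) ∞ e.symm e.target :=
    contMDiffOn_symm_of_mem_maximalAtlas (IsManifold.subset_maximalAtlas he)
  have hT := hs.continuousOn_tangentMapWithin (by simp) e.open_target.uniqueMDiffOn
  have hv : ∀ v : Eu d, ContinuousOn (fun y => (⟨e.symm y, mfderiv (𝓡 d) (𝓡 d) e.symm y v⟩ :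
      TangentBundle (𝓡 d) X)) e.target := by
    intro v
    have hc : Continuous (fun y : Eu d => (⟨y, v⟩ : TangentBundle (𝓡 d) (Eu d))) :=
      (tangentBundleModelSpaceHomeomorph (𝓡 d)).symm.continuous.comp
        (by fun_prop : Continuous fun y : Eu d => ((y, v) : ModelProd (Eu d) (Eu d)))
    refine (hT.comp hc.continuousOn (fun y hy => hy)).congr fun y hy => ?_
    simp only [Function.comp_apply, tangentMapWithin]
    rw [mfderivWithin_of_isOpen e.open_target hy]
  have hg : ∀ i j : Fin d, ContinuousOn (fun y => h.inner (e.symm y)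
      (mfderiv (𝓡 d) (𝓡 d) e.symm y (stdBasis i)) (mfderiv (𝓡 d) (𝓡 d) e.symm y (stdBasis j)))
      e.target := by
    intro i j
    have hc : ContinuousOn (fun y => Bundle.TotalSpace.mk' ℝ (E := Bundle.Trivial X ℝ) (e.symm y)
        (h.inner (e.symm y) (mfderiv (𝓡 d) (𝓡 d) e.symm y (stdBasis i))
          (mfderiv (𝓡 d) (𝓡 d) e.symm y (stdBasis j)))) e.target :=
      ContinuousOn.clm_bundle_apply₂ (F₁ := Eu d) (F₂ := Eu d)
        (h.contMDiff.continuous.comp_continuousOn e.continuousOn_symm)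
        (hv (stdBasis i)) (hv (stdBasis j))
    intro y hy
    have := hc y hy
    simp only [FiberBundle.continuousWithinAt_totalSpace] at this
    exact this.2
  unfold chartDensity parVol
  refine ContinuousOn.sqrt ?_
  have : ContinuousOn (fun y => (Matrix.of fun i j : Fin d => h.inner (e.symm y)
      (mfderiv (𝓡 d) (𝓡 d) e.symm y (stdBasis i))
      (mfderiv (𝓡 d) (𝓡 d) e.symm y (stdBasis j)))) e.target :=
    continuousOn_pi.2 fun i => continuousOn_pi.2 fun j => hg i j
  exact (Continuous.matrix_det continuous_id).comp_continuousOn this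

theorem chartDensity_pos (h : RMetric d X) {e : OpenPartialHomeomorph X (Eu d)}
    (he : e ∈ atlas (Eu d) X) {y : Eu d} (hy : y ∈ e.target) : 0 < chartDensity h e y :=
  parVol_pos h _ (mfderiv (𝓡 d) (𝓡 d) e.symm y)
    ((mdifferentiable_of_mem_atlas (I := 𝓡 d)
      (by exact he)).symm.mfderiv_injective hy)

end Jacobian

/-! ### Smooth maps in charts and change of variables for chart volumes. -/

section Charts

variable {d : ℕ} {X : Type*} [TopologicalSpace X] [ChartedSpace (Eu d) X]
  [IsManifold (𝓡 d) ∞ X]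

theorem parVol_congr (h : RMetric d X) {x x' : X} (hx : x = x') {v w : Fin d → Eu d}
    (hvw : v = w) : parVol h x v = parVol h x' w := by
  subst hx hvw; rfl

theorem parVol_mfderiv_congr (h : RMetric d X) {F G : Eu d → X} {y : Eu d}
    (hFG : F =ᶠ[nhds y] G) :
    parVol h (F y) (fun i => mfderiv (𝓡 d) (𝓡 d) F y (stdBasis i)) =
      parVol h (G y) (fun i => mfderiv (𝓡 d) (𝓡 d) G y (stdBasis i)) := by
  refine parVol_congr h hFG.eq_of_nhds (funext fun i => ?_)
  have := hFG.mfderiv_eq (I := 𝓡 d) (I' := 𝓡 d)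
  exact congrArg (fun L : Eu d →L[ℝ] Eu d => L (stdBasis i)) this

/-- The points of the chart `e` that `φ` maps to the domain of the chart `e'`, in coordinates. -/
def repDomain (φ : X → X) (e e' : OpenPartialHomeomorph X (Eu d)) : Set (Eu d) :=
  e.target ∩ e.symm ⁻¹' (φ ⁻¹' e'.source)

variable {φ : X → X} {e e' : OpenPartialHomeomorph X (Eu d)}

theorem isOpen_repDomain (hφ : Continuous φ) : IsOpen (repDomain φ e e') :=
  e.isOpen_inter_preimage_symm (e'.open_source.preimage hφ)

theorem contDiffOn_rep (hφ : ContMDiff (𝓡 d) (𝓡 d) ∞ φ) (he : e ∈ atlas (Eu d) X)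
    (he' : e' ∈ atlas (Eu d) X) :
    ContDiffOn ℝ ∞ (e' ∘ φ ∘ e.symm) (repDomain φ e e') := by
  have h1 : ContMDiffOn (𝓡 d) (𝓡 d) ∞ e.symm e.target :=
    contMDiffOn_symm_of_mem_maximalAtlas (IsManifold.subset_maximalAtlas he)
  have h2 : ContMDiffOn (𝓡 d) (𝓡 d) ∞ e' e'.source :=
    contMDiffOn_of_mem_maximalAtlas (IsManifold.subset_maximalAtlas he')
  exact (h2.comp (hφ.comp_contMDiffOn (h1.mono inter_subset_left))
    (fun y hy => hy.2)).contDiffOn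

theorem hasFDerivAt_rep (hφ : ContMDiff (𝓡 d) (𝓡 d) ∞ φ) (he : e ∈ atlas (Eu d) X)
    (he' : e' ∈ atlas (Eu d) X) {y : Eu d} (hy : y ∈ repDomain φ e e') :
    HasFDerivAt (e' ∘ φ ∘ e.symm) (fderiv ℝ (e' ∘ φ ∘ e.symm) y) y :=
  (((contDiffOn_rep hφ he he').contDiffAt
    ((isOpen_repDomain hφ.continuous).mem_nhds hy)).differentiableAt (by simp)).hasFDerivAt

/-- Near `y` one has `e'.symm ∘ f = φ ∘ e.symm`. The chain rule computes the volume of the image of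
the standard frame in two ways: through `det Df`, and through the Jacobian of `φ`. -/
theorem chartDensity_mul_det (h : RMetric d X) (hφ : ContMDiff (𝓡 d) (𝓡 d) ∞ φ)
    (he : e ∈ atlas (Eu d) X) (he' : e' ∈ atlas (Eu d) X) {y : Eu d}
    (hy : y ∈ repDomain φ e e') :
    |(fderiv ℝ (e' ∘ φ ∘ e.symm) y).det| * chartDensity h e' ((e' ∘ φ ∘ e.symm) y) =
      riemJacobian h φ (e.symm y) * chartDensity h e y := by
  set f := e' ∘ φ ∘ e.symm with hf
  have hfd : MDifferentiableAt (𝓡 d) (𝓡 d) f y :=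
    (hasFDerivAt_rep hφ he he' hy).differentiableAt.mdifferentiableAt
  have hes : MDifferentiableAt (𝓡 d) (𝓡 d) e.symm y := mdifferentiableAt_atlas_symm he hy.1
  have hes' : MDifferentiableAt (𝓡 d) (𝓡 d) e'.symm (f y) :=
    mdifferentiableAt_atlas_symm he' (e'.map_source hy.2)
  have hφd : MDifferentiableAt (𝓡 d) (𝓡 d) φ (e.symm y) := hφ.mdifferentiable (by simp) _
  have hFG : (e'.symm ∘ f) =ᶠ[nhds y] (φ ∘ e.symm) := by
    filter_upwards [(isOpen_repDomain hφ.continuous).mem_nhds hy] with z hz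
    exact e'.left_inv hz.2
  have key := parVol_mfderiv_congr h hFG
  rw [mfderiv_comp y hes' hfd, mfderiv_comp y hφd hes] at key
  have h1 := riemJacobian_mul_parVol h φ (e.symm y) (mfderiv (𝓡 d) (𝓡 d) e.symm y)
  have h2 := parVol_comp h (e'.symm (f y)) (mfderiv (𝓡 d) (𝓡 d) e'.symm (f y)) (fderiv ℝ f y)
  rw [mfderiv_eq_fderiv] at key
  exact h2.symm.trans (key.trans h1.symm)

/-- Differentiating `ψ ∘ φ = id` shows that the differential of `φ` is injective. -/
theorem riemJacobian_pos (h : RMetric d X) {ψ : X → X} (hφ : ContMDiff (𝓡 d) (𝓡 d) ∞ φ)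
    (hψ : ContMDiff (𝓡 d) (𝓡 d) ∞ ψ) (hl : Function.LeftInverse ψ φ) (x : X) :
    0 < riemJacobian h φ x := by
  refine div_pos (parVol_pos h _ (mfderiv (𝓡 d) (𝓡 d) φ x) ?_) (parVol_stdBasis_pos h x)
  have hc := mfderiv_comp x (hψ.mdifferentiable (by simp) (φ x)) (hφ.mdifferentiable (by simp) x)
  rw [show ψ ∘ φ = id from funext hl, mfderiv_id] at hc
  intro u v huv
  have hu := congrArg (fun L : Eu d →L[ℝ] Eu d => L u) hc
  have hv := congrArg (fun L : Eu d →L[ℝ] Eu d => L v) hc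
  refine hu.trans (Eq.trans ?_ hv.symm)
  exact congrArg (mfderiv (𝓡 d) (𝓡 d) ψ (φ x)) huv

theorem riemJacobian_eq_one (h : RMetric d X) {x : X} (hφ : φ =ᶠ[nhds x] id) :
    riemJacobian h φ x = 1 := by
  have : parVol h (φ x) (fun i => mfderiv (𝓡 d) (𝓡 d) φ x (stdBasis i)) =
      parVol h x (fun i => stdBasis i) := by
    refine parVol_congr h hφ.eq_of_nhds (funext fun i => ?_)
    have := hφ.mfderiv_eq (I := 𝓡 d) (I' := 𝓡 d)
    rw [mfderiv_id] at this
    exact congrArg (fun L : Eu d →L[ℝ] Eu d => L (stdBasis i)) this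
  rw [riemJacobian, this, div_self (parVol_stdBasis_pos h x).ne']

/-- Numerator and denominator of the definition need not be continuous separately, since the
standard frame at `x` refers to the preferred chart at `x`. Solving `chartDensity_mul_det` in fixed
charts for the Jacobian gives a quotient of continuous functions. -/
theorem continuous_riemJacobian (h : RMetric d X) (hφ : ContMDiff (𝓡 d) (𝓡 d) ∞ φ) :
    Continuous (riemJacobian h φ) := by
  refine continuous_iff_continuousAt.2 fun x => ?_
  set e := chartAt (Eu d) x
  set e' := chartAt (Eu d) (φ x)
  have he : e ∈ atlas (Eu d) X := chart_mem_atlas _ _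
  have he' : e' ∈ atlas (Eu d) X := chart_mem_atlas _ _
  have hx : x ∈ e.source := mem_chart_source _ _
  have hx' : φ x ∈ e'.source := mem_chart_source _ _
  set f := e' ∘ φ ∘ e.symm with hf
  have hxU : e x ∈ repDomain φ e e' := ⟨e.map_source hx, by simpa [e.left_inv hx] using hx'⟩
  have hU := isOpen_repDomain (e := e) (e' := e') hφ.continuous
  have hev : ∀ᶠ z in nhds x, e z ∈ repDomain φ e e' :=
    (e.continuousAt hx).eventually (hU.mem_nhds hxU)
  have heq : riemJacobian h φ =ᶠ[nhds x] fun z =>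
      |(fderiv ℝ f (e z)).det| * chartDensity h e' (f (e z)) / chartDensity h e (e z) := by
    filter_upwards [hev, e.open_source.mem_nhds hx] with z hz hzs
    rw [eq_div_iff (chartDensity_pos h he hz.1).ne', chartDensity_mul_det h hφ he he' hz,
      e.left_inv hzs]
  refine ContinuousAt.congr ?_ heq.symm
  have hcf : ContDiffAt ℝ ∞ f (e x) := (contDiffOn_rep hφ he he').contDiffAt (hU.mem_nhds hxU)
  have h1 : ContinuousAt (fun z => (fderiv ℝ f (e z)).det) x :=
    (ContinuousLinearMap.continuous_det.continuousAt).comp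
      (((contDiffOn_rep hφ he he').continuousOn_fderiv_of_isOpen hU (by simp)).continuousAt
        (hU.mem_nhds hxU) |>.comp (e.continuousAt hx))
  have h2 : ContinuousAt (fun z => chartDensity h e' (f (e z))) x := by
    have h3 : ContinuousAt (chartDensity h e') (f (e x)) :=
      (continuousOn_chartDensity h he').continuousAt
        (e'.open_target.mem_nhds (e'.map_source hxU.2))
    exact ContinuousAt.comp (f := fun z => f (e z)) h3
      (ContinuousAt.comp (f := e) (g := f) hcf.continuousAt (e.continuousAt hx))
  have h4 : ContinuousAt (fun z => chartDensity h e (e z)) x :=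
    ContinuousAt.comp (f := e) (g := chartDensity h e)
      ((continuousOn_chartDensity h he).continuousAt
        (e.open_target.mem_nhds hxU.1)) (e.continuousAt hx)
  exact (h1.abs.mul h2).div h4 (chartDensity_pos h he hxU.1).ne'

variable [MeasurableSpace X] [BorelSpace X]

theorem measurableSet_chart_preimage (e : OpenPartialHomeomorph X (Eu d)) {S : Set X}
    (hS : MeasurableSet S) : MeasurableSet (e.target ∩ e.symm ⁻¹' S) := by
  have h1 : Measurable (e.target.domRestrict e.symm) :=
    (continuousOn_iff_continuous_domRestrict.1 e.continuousOn_symm).measurable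
  have h2 := e.open_target.measurableSet.subtype_image (h1 hS)
  convert h2 using 1
  ext y
  simp [domRestrict, and_comm]

theorem aemeasurable_symm_chart (e : OpenPartialHomeomorph X (Eu d)) :
    AEMeasurable e.symm ((volume : Measure (Eu d)).restrict e.target) :=
  e.continuousOn_symm.aemeasurable e.open_target.measurableSet

theorem aemeasurable_chartDensity (h : RMetric d X) (he : e ∈ atlas (Eu d) X) :
    AEMeasurable (fun y => ENNReal.ofReal (chartDensity h e y))
      ((volume : Measure (Eu d)).restrict e.target) :=
  ((continuousOn_chartDensity h he).aemeasurable e.open_target.measurableSet).ennreal_ofReal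

theorem lintegral_chartVolume (h : RMetric d X) (he : e ∈ atlas (Eu d) X) {g : X → ENNReal}
    (hg : Measurable g) :
    ∫⁻ x, g x ∂chartVolume h e =
      ∫⁻ y in e.target, ENNReal.ofReal (chartDensity h e y) * g (e.symm y) := by
  rw [chartVolume, lintegral_map' hg.aemeasurable
    ((aemeasurable_symm_chart e).mono_ac (withDensity_absolutelyContinuous _ _))]
  exact lintegral_withDensity_eq_lintegral_mul₀ (aemeasurable_chartDensity h he)
      (hg.comp_aemeasurable (aemeasurable_symm_chart e))

theorem setLIntegral_chartVolume (h : RMetric d X) (he : e ∈ atlas (Eu d) X) {g : X → ENNReal}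
    (hg : Measurable g) {S : Set X} (hS : MeasurableSet S) :
    ∫⁻ x in S, g x ∂chartVolume h e =
      ∫⁻ y in e.target ∩ e.symm ⁻¹' S,
        ENNReal.ofReal (chartDensity h e y) * g (e.symm y) := by
  rw [← lintegral_indicator hS, lintegral_chartVolume h he (hg.indicator hS),
    ← lintegral_indicator (measurableSet_chart_preimage e hS),
    ← lintegral_indicator e.open_target.measurableSet]
  refine lintegral_congr fun y => ?_
  by_cases h1 : y ∈ e.target <;> by_cases h2 : e.symm y ∈ S <;> simp [indicator, h1, h2]

theorem chartVolume_apply (h : RMetric d X) (he : e ∈ atlas (Eu d) X) {S : Set X}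
    (hS : MeasurableSet S) :
    chartVolume h e S =
      ∫⁻ y in e.target ∩ e.symm ⁻¹' S, ENNReal.ofReal (chartDensity h e y) := by
  rw [← setLIntegral_one, setLIntegral_chartVolume h he measurable_const hS]
  simp

/-- This is the Euclidean change of variables for the coordinate representation of `φ`;
`chartDensity_mul_det` turns its determinant into the Riemannian Jacobian. -/
theorem chartVolume_image (h : RMetric d X) (hφ : ContMDiff (𝓡 d) (𝓡 d) ∞ φ)
    (hφi : Function.Injective φ) (he : e ∈ atlas (Eu d) X) (he' : e' ∈ atlas (Eu d) X) {S : Set X}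
    (hS : MeasurableSet S) (hφS : MeasurableSet (φ '' S)) (hSe : S ⊆ e.source)
    (hSe' : S ⊆ φ ⁻¹' e'.source) :
    chartVolume h e' (φ '' S) = ∫⁻ x in S, ENNReal.ofReal (riemJacobian h φ x)
      ∂chartVolume h e := by
  set f := e' ∘ φ ∘ e.symm with hf
  have hsub : e.target ∩ e.symm ⁻¹' S ⊆ repDomain φ e e' := fun y hy => ⟨hy.1, hSe' hy.2⟩
  have himg : e'.target ∩ e'.symm ⁻¹' (φ '' S) = f '' (e.target ∩ e.symm ⁻¹' S) := by
    ext z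
    constructor
    · rintro ⟨hz, x, hx, hxz⟩
      refine ⟨e x, ⟨e.map_source (hSe hx), by rwa [mem_preimage, e.left_inv (hSe hx)]⟩, ?_⟩
      rw [hf, Function.comp_apply, Function.comp_apply, e.left_inv (hSe hx), hxz, e'.right_inv hz]
    · rintro ⟨y, hy, rfl⟩
      refine ⟨e'.map_source (hSe' hy.2), e.symm y, hy.2, ?_⟩
      exact (e'.left_inv (hSe' hy.2)).symm
  have hinj : InjOn f (e.target ∩ e.symm ⁻¹' S) := by
    intro y hy z hz hyz
    have h1 := e'.injOn (hSe' hy.2) (hSe' hz.2) hyz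
    exact e.symm.injOn hy.1 hz.1 (hφi h1)
  rw [chartVolume_apply h he' hφS, himg,
    lintegral_image_eq_lintegral_abs_det_fderiv_mul volume (measurableSet_chart_preimage e hS)
      (fun y hy => (hasFDerivAt_rep hφ he he' (hsub hy)).hasFDerivWithinAt) hinj,
    setLIntegral_chartVolume h he
      (continuous_riemJacobian h hφ).measurable.ennreal_ofReal hS]
  refine setLIntegral_congr_fun (measurableSet_chart_preimage e hS) fun y hy => ?_
  beta_reduce
  rw [← ENNReal.ofReal_mul (abs_nonneg _), chartDensity_mul_det h hφ he he' (hsub hy), mul_comm,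
    ENNReal.ofReal_mul (chartDensity_pos h he hy.1).le]

end Charts

/-! ### The Riemannian volume as a glued measure and its transformation under diffeomorphisms. -/

section Global

variable {d : ℕ} {X : Type*} [TopologicalSpace X] [ChartedSpace (Eu d) X]
  [IsManifold (𝓡 d) ∞ X] [MeasurableSpace X] [BorelSpace X]

/-- The case `φ = id` of `chartVolume_image`: the well-definedness of the Riemannian volume. -/
theorem chartVolume_eq_of_subset (h : RMetric d X) {e e' : OpenPartialHomeomorph X (Eu d)}
    (he : e ∈ atlas (Eu d) X) (he' : e' ∈ atlas (Eu d) X) {S : Set X} (hS : MeasurableSet S)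
    (hSe : S ⊆ e.source) (hSe' : S ⊆ e'.source) : chartVolume h e' S = chartVolume h e S := by
  have := chartVolume_image (φ := id) h contMDiff_id Function.injective_id he he' hS (by simpa) hSe
    hSe'
  simpa [riemJacobian_eq_one h (Filter.EventuallyEq.refl _ id)] using this

theorem chartVolume_inter_source (h : RMetric d X) {e : OpenPartialHomeomorph X (Eu d)}
    (he : e ∈ atlas (Eu d) X) {S : Set X} (hS : MeasurableSet S) :
    chartVolume h e (S ∩ e.source) = chartVolume h e S := by
  rw [chartVolume_apply h he hS, chartVolume_apply h he (hS.inter e.open_source.measurableSet)]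
  congr 2
  ext y
  simp only [mem_inter_iff, mem_preimage]
  exact ⟨fun hy => ⟨hy.1, hy.2.1⟩, fun hy => ⟨hy.1, hy.2, e.map_target hy.1⟩⟩

theorem chartVolume_le_riemVolume (h : RMetric d X) {e : OpenPartialHomeomorph X (Eu d)}
    (he : e ∈ atlas (Eu d) X) : chartVolume h e ≤ riemVolume h :=
  le_iSup₂ (f := fun e (_ : e ∈ atlas (Eu d) X) => chartVolume h e) e he

variable [SecondCountableTopology X] [Nonempty X]

variable (d X) in
/-- A countable measurable partition of a manifold into subsets of domains of charts. -/
theorem exists_chart_partition : ∃ (c : ℕ → OpenPartialHomeomorph X (Eu d)) (P : ℕ → Set X),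
    (∀ n, c n ∈ atlas (Eu d) X) ∧ (∀ n, MeasurableSet (P n)) ∧ (∀ n, P n ⊆ (c n).source) ∧
    Pairwise (Function.onFun Disjoint P) ∧ ⋃ n, P n = univ := by
  obtain ⟨s, hs, hsu⟩ := TopologicalSpace.countable_cover_nhds
    (fun x : X => (chartAt (Eu d) x).open_source.mem_nhds (mem_chart_source (Eu d) x))
  have hne : s.Nonempty := by
    rw [nonempty_iff_ne_empty]
    rintro rfl
    exact empty_ne_univ (by simpa using hsu)
  obtain ⟨u, rfl⟩ := hs.exists_eq_range hne
  refine ⟨fun n => chartAt (Eu d) (u n), disjointed fun n => (chartAt (Eu d) (u n)).source,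
    fun n => chart_mem_atlas _ _, fun n => .disjointed (fun n =>
      (chartAt (Eu d) (u n)).open_source.measurableSet) n, fun n => disjointed_subset _ n,
      disjoint_disjointed _, ?_⟩
  rw [iUnion_disjointed, ← hsu, biUnion_range]

theorem riemVolume_eq_sum (h : RMetric d X) {c : ℕ → OpenPartialHomeomorph X (Eu d)}
    {P : ℕ → Set X} (hc : ∀ n, c n ∈ atlas (Eu d) X) (hP : ∀ n, MeasurableSet (P n))
    (hPc : ∀ n, P n ⊆ (c n).source) (hd : Pairwise (Function.onFun Disjoint P))
    (hu : ⋃ n, P n = univ) :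
    riemVolume h = Measure.sum fun n => (chartVolume h (c n)).restrict (P n) := by
  have hsplit : ∀ (μ : Measure X) {S : Set X}, MeasurableSet S → μ S = ∑' n, μ (S ∩ P n) := by
    intro μ S hS
    rw [← measure_iUnion (fun i j hij => (hd hij).mono inter_subset_right inter_subset_right)
      (fun n => hS.inter (hP n)), ← inter_iUnion, hu, inter_univ]
  have happ : ∀ {S : Set X}, MeasurableSet S →
      (Measure.sum fun n => (chartVolume h (c n)).restrict (P n)) S =
        ∑' n, chartVolume h (c n) (S ∩ P n) := by
    intro S hS
    rw [Measure.sum_apply _ hS]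
    simp_rw [Measure.restrict_apply hS]
  -- Any single chart agrees with `c n` on its overlap with `P n`, so its mass is at most the sum of
  -- the pieces. Conversely each piece lies below the supremum.
  refine le_antisymm (iSup₂_le fun e he => Measure.le_iff.2 fun S hS => ?_)
    (Measure.le_iff.2 fun S hS => ?_)
  · rw [happ hS, ← chartVolume_inter_source h he hS,
      hsplit _ (hS.inter e.open_source.measurableSet)]
    refine ENNReal.tsum_le_tsum fun n => ?_
    rw [chartVolume_eq_of_subset h (hc n) he
      ((hS.inter e.open_source.measurableSet).inter (hP n)) (inter_subset_right.trans (hPc n))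
      (inter_subset_left.trans inter_subset_right)]
    exact measure_mono (inter_subset_inter_left _ inter_subset_left)
  · rw [happ hS, hsplit _ hS]
    exact ENNReal.tsum_le_tsum fun n => chartVolume_le_riemVolume h (hc n) _

theorem riemVolume_apply_of_subset (h : RMetric d X) {e : OpenPartialHomeomorph X (Eu d)}
    (he : e ∈ atlas (Eu d) X) {S : Set X} (hSe : S ⊆ e.source) (hS : MeasurableSet S) :
    riemVolume h S = chartVolume h e S := by
  obtain ⟨c, P, hc, hP, hPc, hd, hu⟩ := exists_chart_partition d X
  rw [riemVolume_eq_sum h hc hP hPc hd hu, Measure.sum_apply _ hS]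
  simp_rw [Measure.restrict_apply hS]
  have : ∀ n, chartVolume h (c n) (S ∩ P n) = chartVolume h e (S ∩ P n) := fun n =>
    chartVolume_eq_of_subset h he (hc n) (hS.inter (hP n)) (inter_subset_left.trans hSe)
      (inter_subset_right.trans (hPc n))
  simp_rw [this]
  rw [← measure_iUnion (fun i j hij => (hd hij).mono inter_subset_right inter_subset_right)
      (fun n => hS.inter (hP n)), ← inter_iUnion, hu, inter_univ]

instance (h : RMetric d X) (e : OpenPartialHomeomorph X (Eu d)) : SFinite (chartVolume h e) := by
  unfold chartVolume; infer_instance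

theorem sFinite_riemVolume (h : RMetric d X) : SFinite (riemVolume h) := by
  obtain ⟨c, P, hc, hP, hPc, hd, hu⟩ := exists_chart_partition d X
  rw [riemVolume_eq_sum h hc hP hPc hd hu]
  infer_instance

theorem riemVolume_singleton [T1Space X] [Nontrivial (Eu d)] (h : RMetric d X) (x : X) :
    riemVolume h {x} = 0 := by
  have hx := mem_chart_source (Eu d) x
  rw [riemVolume_apply_of_subset h (chart_mem_atlas (Eu d) x) (singleton_subset_iff.2 hx)
    (measurableSet_singleton x), chartVolume_apply h (chart_mem_atlas (Eu d) x)
    (measurableSet_singleton x)]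
  refine setLIntegral_measure_zero _ _ (measure_mono_null (t := {chartAt (Eu d) x x}) ?_ ?_)
  · rintro y ⟨hy, hyx⟩
    rw [mem_preimage, mem_singleton_iff] at hyx
    exact ((chartAt (Eu d) x).right_inv hy).symm.trans (congrArg _ hyx)
  · exact measure_singleton _

theorem riemVolume_image (h : RMetric d X) {φ : Equiv.Perm X}
    (hφ : ContMDiff (𝓡 d) (𝓡 d) ∞ φ) (hφ' : ContMDiff (𝓡 d) (𝓡 d) ∞ φ.symm) {S : Set X}
    (hS : MeasurableSet S) :
    riemVolume h (φ '' S) = ∫⁻ x in S, ENNReal.ofReal (riemJacobian h φ x) ∂riemVolume h := by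
  obtain ⟨c, P, hc, hP, hPc, hd, hu⟩ := exists_chart_partition d X
  have himg : ∀ {T : Set X}, MeasurableSet T → MeasurableSet (φ '' T) := by
    intro T hT
    rw [φ.image_eq_preimage_symm]
    exact hφ'.continuous.measurable hT
  -- The double index makes each piece lie in one chart domain while its image lies in another.
  have hT : ∀ k : ℕ × ℕ, MeasurableSet (S ∩ (P k.1 ∩ φ ⁻¹' P k.2)) := fun k =>
    hS.inter ((hP k.1).inter (hφ.continuous.measurable (hP k.2)))
  have hdT : Pairwise (Function.onFun Disjoint fun k : ℕ × ℕ => S ∩ (P k.1 ∩ φ ⁻¹' P k.2)) := by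
    rintro ⟨i, j⟩ ⟨k, l⟩ hne
    refine disjoint_left.2 ?_
    rintro x ⟨-, h1, h2⟩ ⟨-, h3, h4⟩
    refine hne (Prod.ext ?_ ?_)
    · exact by_contra fun hik => (disjoint_left.1 (hd hik)) h1 h3
    · exact by_contra fun hik => (disjoint_left.1 (hd hik)) h2 h4
  have hST : S = ⋃ k : ℕ × ℕ, S ∩ (P k.1 ∩ φ ⁻¹' P k.2) := by
    ext x
    simp only [mem_iUnion, mem_inter_iff, Prod.exists]
    refine ⟨fun hx => ?_, fun ⟨i, j, hx⟩ => hx.1⟩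
    obtain ⟨i, hi⟩ := mem_iUnion.1 (hu.symm ▸ mem_univ x : x ∈ ⋃ n, P n)
    obtain ⟨j, hj⟩ := mem_iUnion.1 (hu.symm ▸ mem_univ (φ x) : φ x ∈ ⋃ n, P n)
    exact ⟨i, j, hx, hi, hj⟩
  have hpiece : ∀ k : ℕ × ℕ, riemVolume h (φ '' (S ∩ (P k.1 ∩ φ ⁻¹' P k.2))) =
      ∫⁻ x in S ∩ (P k.1 ∩ φ ⁻¹' P k.2), ENNReal.ofReal (riemJacobian h φ x) ∂riemVolume h := by
    intro k
    have hs1 : S ∩ (P k.1 ∩ φ ⁻¹' P k.2) ⊆ (c k.1).source := fun x hx => hPc _ hx.2.1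
    have hs2 : S ∩ (P k.1 ∩ φ ⁻¹' P k.2) ⊆ φ ⁻¹' (c k.2).source := fun x hx => hPc _ hx.2.2
    rw [riemVolume_apply_of_subset h (hc k.2) (image_subset_iff.2 hs2) (himg (hT k)),
      chartVolume_image h hφ φ.injective (hc k.1) (hc k.2) (hT k) (himg (hT k)) hs1 hs2]
    congr 1
    ext T hTm
    rw [Measure.restrict_apply hTm, Measure.restrict_apply hTm,
      riemVolume_apply_of_subset h (hc k.1) (inter_subset_right.trans hs1) (hTm.inter (hT k))]
  conv_lhs => rw [hST]
  conv_rhs => rw [hST]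
  rw [image_iUnion, lintegral_iUnion hT hdT, measure_iUnion ?_ fun k => himg (hT k)]
  · exact tsum_congr hpiece
  · exact fun i j hij => (disjoint_image_iff φ.injective).2 (hdT hij)

/-- The change of variables formula for the Riemannian volume. -/
theorem map_riemVolume (h : RMetric d X) {ψ : Equiv.Perm X}
    (hψ : ContMDiff (𝓡 d) (𝓡 d) ∞ ψ) (hψ' : ContMDiff (𝓡 d) (𝓡 d) ∞ ψ.symm) :
    (riemVolume h).map ψ =
      (riemVolume h).withDensity fun x => ENNReal.ofReal (riemJacobian h ψ.symm x) := by
  ext S hS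
  rw [Measure.map_apply hψ.continuous.measurable hS, withDensity_apply _ hS,
    ← riemVolume_image h hψ' hψ hS, ψ.image_symm_eq_preimage]

end Global

/-! ### Lebesgue measure on the marks and its scaling. -/

section MarkMeasure

theorem measurableEmbedding_mark : MeasurableEmbedding (Subtype.val : Mark → ℝ) :=
  MeasurableEmbedding.subtype_coe measurableSet_Ioi

instance : SigmaFinite markLebesgue :=
  have : SigmaFinite (markLebesgue.map Subtype.val) := by
    rw [markLebesgue, measurableEmbedding_mark.map_comap]
    infer_instance
  SigmaFinite.of_map _ measurable_subtype_coe.aemeasurable this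

theorem markLebesgue_apply (S : Set Mark) : markLebesgue S = volume (Subtype.val '' S) :=
  measurableEmbedding_mark.comap_apply _ S

theorem markLebesgue_preimage_mul (c : Mark) (S : Set Mark) :
    markLebesgue ((fun s => c * s) ⁻¹' S) = (ENNReal.ofReal (c : ℝ))⁻¹ * markLebesgue S := by
  have : (Subtype.val '' ((fun s => c * s) ⁻¹' S) : Set ℝ) =
      (fun t => (c : ℝ) * t) ⁻¹' (Subtype.val '' S) := by
    ext t
    constructor
    · rintro ⟨s, hs, rfl⟩
      exact ⟨c * s, hs, rfl⟩
    · rintro ⟨s, hs, hst⟩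
      have ht : 0 < t := by
        have := s.2
        rw [hst] at this
        exact (pos_iff_pos_of_mul_pos this).1 c.2
      refine ⟨⟨t, ht⟩, ?_, rfl⟩
      have : c * ⟨t, ht⟩ = s := Subtype.ext hst.symm
      rwa [mem_preimage, this]
  rw [markLebesgue_apply, markLebesgue_apply, this, Real.volume_preimage_mul_left c.2.ne',
    abs_of_pos (inv_pos.2 c.2), ENNReal.ofReal_inv_of_pos c.2]

end MarkMeasure

/-! ### The group action on `X × ℝ₊` and the image of `m ⊗ λ`. -/

section GroupAction

variable {d : ℕ} {X : Type*} [TopologicalSpace X] [ChartedSpace (Eu d) X]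

theorem MarkGroup.contMDiff_diffeo (g : MarkGroup d X) : ContMDiff (𝓡 d) (𝓡 d) ∞ g.diffeo :=
  (SemidirectProduct.right g).2.1

theorem MarkGroup.contMDiff_diffeo_symm (g : MarkGroup d X) :
    ContMDiff (𝓡 d) (𝓡 d) ∞ g.diffeo.symm :=
  (SemidirectProduct.right g).2.2.1

theorem MarkGroup.exists_compact_support (g : MarkGroup d X) :
    ∃ K : Set X, IsCompact K ∧ (∀ x ∉ K, g.diffeo x = x) ∧ ∀ x ∉ K, g.current x = 1 := by
  obtain ⟨-, -, K, hK, h⟩ := (SemidirectProduct.right g).2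
  obtain ⟨-, K', hK', h'⟩ := (SemidirectProduct.left g).2
  exact ⟨K ∪ K', hK.union hK', fun x hx => h x fun hx' => hx (.inl hx'),
    fun x hx => h' x fun hx' => hx (.inr hx')⟩

theorem MarkGroup.continuous_current (g : MarkGroup d X) : Continuous g.current :=
  Continuous.subtype_mk (SemidirectProduct.left g).2.1.continuous _

theorem MarkGroup.smul_def (g : MarkGroup d X) (z : X × Mark) :
    g • z = (g.diffeo z.1, g.current (g.diffeo z.1) * z.2) := rfl

theorem MarkGroup.inv_smul_eq (g : MarkGroup d X) (z : X × Mark) :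
    g⁻¹ • z = (g.diffeo.symm z.1, (g.current z.1)⁻¹ * z.2) := by
  rw [inv_smul_eq_iff, MarkGroup.smul_def]
  simp

theorem continuous_markGroup_smul (g : MarkGroup d X) :
    Continuous fun z : X × Mark => g • z := by
  have h1 := g.contMDiff_diffeo.continuous
  have h2 := g.continuous_current
  have h3 : Continuous fun z : X × Mark => g.current (g.diffeo z.1) * z.2 :=
    Continuous.subtype_mk ((continuous_subtype_val.comp (h2.comp (h1.comp continuous_fst))).mul
      (continuous_subtype_val.comp continuous_snd)) _
  exact (h1.comp continuous_fst).prodMk h3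

variable [MeasurableSpace X] [BorelSpace X]

theorem measurable_markGroup_smul [SecondCountableTopology X] (g : MarkGroup d X) :
    Measurable fun z : X × Mark => g • z :=
  (continuous_markGroup_smul g).measurable

variable [IsManifold (𝓡 d) ∞ X] [SecondCountableTopology X]

/-- The density of the image of `m ⊗ λ` under `g`. -/
def productDensity (h : RMetric d X) (g : MarkGroup d X) (z : X × Mark) : ENNReal :=
  ENNReal.ofReal (riemJacobian h g.diffeo.symm z.1) * (ENNReal.ofReal (g.current z.1 : ℝ))⁻¹

theorem measurable_ofReal_riemJacobian (h : RMetric d X) (g : MarkGroup d X) :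
    Measurable fun x => ENNReal.ofReal (riemJacobian h g.diffeo.symm x) :=
  (continuous_riemJacobian h g.contMDiff_diffeo_symm).measurable.ennreal_ofReal

theorem measurable_ofReal_current (g : MarkGroup d X) :
    Measurable fun x => ENNReal.ofReal (g.current x : ℝ) :=
  (continuous_subtype_val.comp g.continuous_current).measurable.ennreal_ofReal

theorem measurable_productDensity (h : RMetric d X) (g : MarkGroup d X) :
    Measurable (productDensity h g) :=
  ((measurable_ofReal_riemJacobian h g).mul (measurable_ofReal_current g).inv).comp measurable_fst

theorem map_prod_markGroup_smul [Nonempty X] (h : RMetric d X) (g : MarkGroup d X) :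
    ((riemVolume h).prod markLebesgue).map (fun z => g • z) =
      ((riemVolume h).prod markLebesgue).withDensity (productDensity h g) := by
  ext S hS
  have hm := measurable_ofReal_riemJacobian h g
  have hc := (measurable_ofReal_current g).inv
  have hSx := measurable_measure_prodMk_left (ν := markLebesgue) hS
  rw [Measure.map_apply (measurable_markGroup_smul g) hS,
    Measure.prod_apply (measurable_markGroup_smul g hS), withDensity_apply _ hS,
    ← lintegral_indicator hS,
    lintegral_prod _ ((measurable_productDensity h g).indicator hS).aemeasurable]
  -- The current is evaluated at the image point, so the fibre measure is a function of `g.diffeo x`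
  -- and the integral over `x` transforms by `map_riemVolume`.
  have h1 : ∀ x, markLebesgue (Prod.mk x ⁻¹' ((fun z : X × Mark => g • z) ⁻¹' S)) =
      (fun x' => (ENNReal.ofReal (g.current x' : ℝ))⁻¹ * markLebesgue (Prod.mk x' ⁻¹' S))
        (g.diffeo x) := fun x =>
    markLebesgue_preimage_mul (g.current (g.diffeo x)) (Prod.mk (g.diffeo x) ⁻¹' S)
  have hG : Measurable fun x' => (ENNReal.ofReal (g.current x' : ℝ))⁻¹ *
      markLebesgue (Prod.mk x' ⁻¹' S) := hc.mul hSx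
  rw [lintegral_congr h1, ← lintegral_map hG g.contMDiff_diffeo.continuous.measurable,
    map_riemVolume h g.contMDiff_diffeo g.contMDiff_diffeo_symm,
    lintegral_withDensity_eq_lintegral_mul _ hm hG]
  refine lintegral_congr fun x => ?_
  have h2 : ∀ s, S.indicator (productDensity h g) (x, s) =
      (Prod.mk x ⁻¹' S).indicator (fun _ => productDensity h g (x, 1)) s := fun s => rfl
  simp_rw [h2]
  rw [lintegral_indicator_const (measurable_prodMk_left hS)]
  simp [productDensity, mul_assoc]

theorem quasiMeasurePreserving_markGroup_smul [Nonempty X] (h : RMetric d X) (g : MarkGroup d X) :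
    Measure.QuasiMeasurePreserving (fun z : X × Mark => g • z)
      ((riemVolume h).prod markLebesgue) ((riemVolume h).prod markLebesgue) :=
  ⟨measurable_markGroup_smul g, by
    rw [map_prod_markGroup_smul]; exact withDensity_absolutelyContinuous _ _⟩

end GroupAction

/-! ### The density of the transformed Lévy measure. -/

section Density

variable {d : ℕ} {X : Type*} [TopologicalSpace X] [ChartedSpace (Eu d) X]
  [MeasurableSpace X] [BorelSpace X] [IsManifold (𝓡 d) ∞ X] [SecondCountableTopology X]
  {h : RMetric d X} {ρ : X → ENNReal} {p : X → Mark → ENNReal}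

theorem measurable_qFun (hρ : Measurable ρ) (hp : Measurable (Function.uncurry p)) :
    Measurable (qFun ρ p) :=
  (hρ.comp measurable_fst).mul hp

theorem ae_qFun_pos (hρ : Measurable ρ) (hp : Measurable (Function.uncurry p))
    (hρ_pos : ∀ᵐ x ∂(riemVolume h), 0 < ρ x)
    (hp_pos : ∀ᵐ x ∂(riemVolume h), ∀ᵐ s ∂markLebesgue, 0 < p x s) :
    ∀ᵐ z ∂((riemVolume h).prod markLebesgue), 0 < qFun ρ p z := by
  rw [Measure.ae_prod_iff_ae_ae (measurableSet_lt measurable_const (measurable_qFun hρ hp))]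
  filter_upwards [hρ_pos, hp_pos] with x hx hx'
  filter_upwards [hx'] with s hs
  exact ENNReal.mul_pos hx.ne' hs.ne'

/-- Over each set of a compact exhaustion `q` has finite integral, hence is finite almost everywhere
there. -/
theorem ae_qFun_lt_top [T2Space X] (hρ : Measurable ρ) (hp : Measurable (Function.uncurry p))
    (hfin : ∀ K : Set X, IsCompact K → levyMeasure h ρ p (K ×ˢ univ) < ⊤) :
    ∀ᵐ z ∂((riemVolume h).prod markLebesgue), qFun ρ p z < ⊤ := by
  have : LocallyCompactSpace X := ChartedSpace.locallyCompactSpace (Eu d) X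
  have hK : ∀ n, ∀ᵐ z ∂((riemVolume h).prod markLebesgue),
      z ∈ (compactCovering X n ×ˢ univ : Set (X × Mark)) → qFun ρ p z < ⊤ := by
    intro n
    have hm : MeasurableSet (compactCovering X n ×ˢ univ : Set (X × Mark)) :=
      (isCompact_compactCovering X n).measurableSet.prod .univ
    rw [← ae_restrict_iff' hm]
    refine ae_lt_top (measurable_qFun hρ hp) ?_
    have := hfin _ (isCompact_compactCovering X n)
    rw [levyMeasure, withDensity_apply _ hm] at this
    exact this.ne
  filter_upwards [ae_all_iff.2 hK] with z hz
  obtain ⟨n, hn⟩ := mem_iUnion.1 (iUnion_compactCovering X ▸ mem_univ z.1 :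
    z.1 ∈ ⋃ n, compactCovering X n)
  exact hz n ⟨hn, mem_univ _⟩

theorem groupDensity_eq (g : MarkGroup d X) (z : X × Mark) [Decidable
    ((0 < qFun ρ p z ∧ qFun ρ p z < ⊤) ∧ (0 < qFun ρ p (g⁻¹ • z) ∧ qFun ρ p (g⁻¹ • z) < ⊤))] :
    groupDensity h ρ p g z =
      if (0 < qFun ρ p z ∧ qFun ρ p z < ⊤) ∧ (0 < qFun ρ p (g⁻¹ • z) ∧ qFun ρ p (g⁻¹ • z) < ⊤) then
        qFun ρ p (g⁻¹ • z) / (qFun ρ p z * ENNReal.ofReal (g.current z.1 : ℝ)) *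
          ENNReal.ofReal (riemJacobian h g.diffeo.symm z.1)
      else 1 := by
  simp only [g.inv_smul_eq, groupDensity]

theorem ofReal_current_ne_zero (g : MarkGroup d X) (x : X) :
    ENNReal.ofReal (g.current x : ℝ) ≠ 0 :=
  (ENNReal.ofReal_pos.2 (g.current x).2).ne'

theorem ofReal_riemJacobian_ne_zero (g : MarkGroup d X) (x : X) :
    ENNReal.ofReal (riemJacobian h g.diffeo.symm x) ≠ 0 :=
  (ENNReal.ofReal_pos.2 (riemJacobian_pos h g.contMDiff_diffeo_symm g.contMDiff_diffeo
    g.diffeo.apply_symm_apply x)).ne'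

theorem groupDensity_ne_top (g : MarkGroup d X) (z : X × Mark) : groupDensity h ρ p g z ≠ ⊤ := by
  classical
  rw [groupDensity_eq]
  split_ifs with hq
  · exact ENNReal.mul_ne_top (ENNReal.div_ne_top hq.2.2.ne
      (mul_ne_zero hq.1.1.ne' (ofReal_current_ne_zero g _))) ENNReal.ofReal_ne_top
  · exact ENNReal.one_ne_top

/-- Together with finiteness this holds at every point, thanks to the default value `1`. Products
over configurations are therefore positive without exceptional sets. -/
theorem groupDensity_ne_zero (g : MarkGroup d X) (z : X × Mark) :
    groupDensity h ρ p g z ≠ 0 := by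
  classical
  rw [groupDensity_eq]
  split_ifs with hq
  · exact mul_ne_zero (ENNReal.div_pos hq.2.1.ne'
      (ENNReal.mul_ne_top hq.1.2.ne ENNReal.ofReal_ne_top)).ne' (ofReal_riemJacobian_ne_zero g _)
  · exact one_ne_zero

theorem measurable_groupDensity (hρ : Measurable ρ) (hp : Measurable (Function.uncurry p))
    (g : MarkGroup d X) : Measurable (groupDensity h ρ p g) := by
  classical
  have hq := measurable_qFun hρ hp
  have hq' : Measurable fun z => qFun ρ p (g⁻¹ • z) := hq.comp (measurable_markGroup_smul g⁻¹)
  rw [show groupDensity h ρ p g = _ from funext fun z => groupDensity_eq g z]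
  refine Measurable.ite ?_ ?_ measurable_const
  · exact ((measurableSet_lt measurable_const hq).inter (measurableSet_lt hq measurable_const)).inter
      ((measurableSet_lt measurable_const hq').inter (measurableSet_lt hq' measurable_const))
  · exact (hq'.div (hq.mul ((measurable_ofReal_current g).comp measurable_fst))).mul
      ((measurable_ofReal_riemJacobian h g).comp measurable_fst)

/-- The set `K` is closed, so `ψ⁻¹` is the identity on a whole neighbourhood of a point outside `K`;
this forces the Jacobian there to be `1`. -/
theorem groupDensity_eq_one [T2Space X] (g : MarkGroup d X) {K : Set X} (hK : IsCompact K)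
    (h1 : ∀ x ∉ K, g.diffeo x = x) (h2 : ∀ x ∉ K, g.current x = 1) {z : X × Mark}
    (hz : z.1 ∉ K) : groupDensity h ρ p g z = 1 := by
  classical
  have hs : ∀ x ∉ K, g.diffeo.symm x = x := fun x hx => by
    rw [Equiv.symm_apply_eq, h1 x hx]
  have hw : g⁻¹ • z = z := by
    rw [g.inv_smul_eq, hs _ hz, h2 _ hz]
    simp
  have hJ : riemJacobian h g.diffeo.symm z.1 = 1 :=
    riemJacobian_eq_one h (by
      filter_upwards [hK.isClosed.isOpen_compl.mem_nhds hz] with x hx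
      exact hs x hx)
  rw [groupDensity_eq, hw, hJ, h2 _ hz]
  split_ifs with hq
  · simp [ENNReal.div_self hq.1.1.ne' hq.1.2.ne]
  · rfl

theorem map_levyMeasure [T2Space X] [Nonempty X] (hρ : Measurable ρ)
    (hp : Measurable (Function.uncurry p)) (hρ_pos : ∀ᵐ x ∂(riemVolume h), 0 < ρ x)
    (hp_pos : ∀ᵐ x ∂(riemVolume h), ∀ᵐ s ∂markLebesgue, 0 < p x s)
    (hfin : ∀ K : Set X, IsCompact K → levyMeasure h ρ p (K ×ˢ univ) < ⊤) (g : MarkGroup d X) :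
    (levyMeasure h ρ p).map (fun z => g • z) =
      (levyMeasure h ρ p).withDensity (groupDensity h ρ p g) := by
  classical
  have hq := measurable_qFun hρ hp
  have hg := measurable_markGroup_smul g
  have hg' := measurable_markGroup_smul g⁻¹
  have hq' : Measurable fun z => qFun ρ p (g⁻¹ • z) := hq.comp hg'
  set μ := (riemVolume h).prod markLebesgue with hμ
  have h1 : (levyMeasure h ρ p).map (fun z => g • z) =
      (μ.map (fun z => g • z)).withDensity fun z => qFun ρ p (g⁻¹ • z) := by
    ext S hS
    rw [Measure.map_apply hg hS, levyMeasure, withDensity_apply _ (hg hS), withDensity_apply _ hS,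
      setLIntegral_map hS hq' hg]
    simp only [inv_smul_smul]
    rfl
  have hae : ∀ᵐ z ∂μ, 0 < qFun ρ p z ∧ qFun ρ p z < ⊤ :=
    (ae_qFun_pos hρ hp hρ_pos hp_pos).and (ae_qFun_lt_top hρ hp hfin)
  rw [h1, map_prod_markGroup_smul, levyMeasure,
    ← withDensity_mul _ (measurable_productDensity h g) hq',
    ← withDensity_mul _ hq (measurable_groupDensity hρ hp g)]
  refine withDensity_congr_ae ?_
  -- Quasiinvariance of `m ⊗ λ` under `g⁻¹` carries `0 < q < ∞` over to `g⁻¹ • z`, so the nondefault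
  -- branch applies almost everywhere.
  filter_upwards [hae, (quasiMeasurePreserving_markGroup_smul h g⁻¹).ae hae] with z hz hz'
  rw [Pi.mul_apply, Pi.mul_apply, groupDensity_eq, if_pos ⟨hz, hz'⟩, productDensity,
    ENNReal.div_eq_inv_mul, ENNReal.mul_inv (.inl hz.1.ne') (.inl hz.2.ne)]
  set a := qFun ρ p z
  calc _ = 1 * (qFun ρ p (g⁻¹ • z) * (ENNReal.ofReal (g.current z.1 : ℝ))⁻¹ *
      ENNReal.ofReal (riemJacobian h g.diffeo.symm z.1)) := by ring
    _ = (a * a⁻¹) * _ := by rw [ENNReal.mul_inv_cancel hz.1.ne' hz.2.ne]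
    _ = _ := by ring

end Density

/-! ### Void events and measurability on the configuration space. -/

theorem measurable_nat_of_Ici {α : Type*} [MeasurableSpace α] {f : α → ℕ}
    (hf : ∀ k, MeasurableSet (f ⁻¹' Ici k)) : Measurable f :=
  measurable_of_Ici hf

section ConfMeasurable

variable {X : Type*} [TopologicalSpace X]

/-- Sets of marked points whose projection to `X` is relatively compact. -/
def RelCompact (B : Set (X × Mark)) : Prop := ∃ K : Set X, IsCompact K ∧ Prod.fst '' B ⊆ K

theorem RelCompact.mono {B C : Set (X × Mark)} (hC : RelCompact C) (h : B ⊆ C) : RelCompact B :=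
  let ⟨K, hK, hCK⟩ := hC
  ⟨K, hK, (image_mono h).trans hCK⟩

theorem RelCompact.union {B C : Set (X × Mark)} (hB : RelCompact B) (hC : RelCompact C) :
    RelCompact (B ∪ C) := by
  obtain ⟨K, hK, hBK⟩ := hB
  obtain ⟨L, hL, hCL⟩ := hC
  exact ⟨K ∪ L, hK.union hL, by rw [image_union]; exact union_subset_union hBK hCL⟩

theorem relCompact_prod {K : Set X} (hK : IsCompact K) : RelCompact (K ×ˢ (univ : Set Mark)) :=
  ⟨K, hK, fst_image_prod_subset _ _⟩

theorem RelCompact.finite_inter {B : Set (X × Mark)} (hB : RelCompact B) (ξ : MConf X) :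
    (ξ.1 ∩ B).Finite := by
  obtain ⟨K, hK, hBK⟩ := hB
  refine Finite.of_finite_image ((ξ.2.2 K hK).subset ?_) (ξ.2.1.mono inter_subset_left)
  rintro _ ⟨z, hz, rfl⟩
  exact ⟨⟨z, hz.1, rfl⟩, hBK ⟨z, hz.2, rfl⟩⟩

/-- The configurations without points in `B`. -/
def voidSet (B : Set (X × Mark)) : Set (MConf X) := {ξ | ξ.1 ∩ B = ∅}

theorem mem_voidSet {B : Set (X × Mark)} {ξ : MConf X} :
    ξ ∈ voidSet B ↔ ∀ z ∈ ξ.1, z ∉ B := by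
  rw [voidSet, mem_ofPred_eq, ← disjoint_iff_inter_eq_empty, disjoint_left]

theorem voidSet_inter (B C : Set (X × Mark)) : voidSet B ∩ voidSet C = voidSet (B ∪ C) := by
  ext ξ
  simp only [mem_inter_iff, mem_voidSet, mem_union, not_or]
  exact ⟨fun h z hz => ⟨h.1 z hz, h.2 z hz⟩, fun h => ⟨fun z hz => (h z hz).1,
    fun z hz => (h z hz).2⟩⟩

theorem restr_val (Λ : Set X) (ξ : MConf X) : (restr Λ ξ).1 = ξ.1 ∩ Λ ×ˢ univ := rfl

theorem restr_preimage_voidSet (Λ : Set X) (B : Set (X × Mark)) :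
    restr Λ ⁻¹' voidSet B = voidSet (B ∩ Λ ×ˢ univ) := by
  ext ξ
  simp only [mem_preimage, mem_voidSet, restr_val, mem_inter_iff]
  exact ⟨fun h z hz hz' => h z ⟨hz, hz'.2⟩ hz'.1, fun h z hz hz' => h z hz.1 ⟨hz', hz.2⟩⟩

variable [MeasurableSpace X]

variable (X) in
/-- The system of the void events of Borel sets with relatively compact projection. -/
def voidSystem : Set (Set (MConf X)) :=
  {V | ∃ B, MeasurableSet B ∧ RelCompact B ∧ V = voidSet B}

theorem measurable_count {B : Set (X × Mark)} (hB : MeasurableSet B) (hB' : RelCompact B) :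
    Measurable (count B) := by
  rw [measurable_iff_comap_le]
  exact le_iSup₂ (f := fun B (_ : B ∈ {B : Set (X × Mark) | MeasurableSet B ∧ RelCompact B}) =>
    MeasurableSpace.comap (count B) ⊤) B ⟨hB, hB'⟩

theorem measurableSet_voidSet {B : Set (X × Mark)} (hB : MeasurableSet B) (hB' : RelCompact B) :
    MeasurableSet (voidSet B) := by
  have : voidSet B = count B ⁻¹' {0} := by
    ext ξ
    rw [mem_preimage, mem_singleton_iff, count, ncard_eq_zero (hB'.finite_inter ξ)]
    rfl
  rw [this]
  exact measurable_count hB hB' (measurableSet_singleton 0)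

theorem isPiSystem_voidSystem : IsPiSystem (voidSystem X) := by
  rintro _ ⟨B, hB, hB', rfl⟩ _ ⟨C, hC, hC', rfl⟩ -
  exact ⟨B ∪ C, hB.union hC, hB'.union hC', voidSet_inter B C⟩

/-- Finitely many points are separated by disjoint basic open sets, and conversely disjoint sets
hold different points. As the basis is countable, this expresses counting events by countable
operations on void events. -/
theorem le_count_iff [T2Space X] [SecondCountableTopology X] {B : Set (X × Mark)}
    (hB : RelCompact B) (k : ℕ) (ξ : MConf X) :
    k ≤ count B ξ ↔ ∃ C : Fin k → TopologicalSpace.countableBasis (X × Mark),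
      (Pairwise fun i j => Disjoint (C i : Set (X × Mark)) (C j)) ∧
        ∀ i, ξ ∉ voidSet (B ∩ (C i : Set (X × Mark))) := by
  have hfin := hB.finite_inter ξ
  constructor
  · intro hk
    rw [count, ncard_eq_toFinset_card _ hfin] at hk
    obtain ⟨t, ht, htk⟩ := Finset.exists_subset_card_eq hk
    obtain ⟨U, hU, hUd⟩ := t.finite_toSet.t2_separation
    let z : Fin k → X × Mark := fun i => (t.equivFinOfCardEq htk).symm i
    have hzt : ∀ i, z i ∈ t := fun i => ((t.equivFinOfCardEq htk).symm i).2
    have hz : Function.Injective z :=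
      Subtype.val_injective.comp (t.equivFinOfCardEq htk).symm.injective
    choose C hC hzC hCU using fun i =>
      (TopologicalSpace.isBasis_countableBasis (X × Mark)).exists_subset_of_mem_open
        (hU (z i)).1 (hU (z i)).2
    refine ⟨fun i => ⟨C i, hC i⟩, fun i j hij => ?_, fun i hi => ?_⟩
    · exact (hUd (hzt i) (hzt j) (hz.ne hij)).mono (hCU i) (hCU j)
    · have hzi := hfin.mem_toFinset.1 (ht (hzt i))
      exact mem_voidSet.1 hi (z i) hzi.1 ⟨hzi.2, hzC i⟩
  · rintro ⟨C, hC, hv⟩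
    simp only [mem_voidSet, not_forall, not_not] at hv
    choose z hz hzB using hv
    have hinj : Function.Injective z := by
      intro i j hij
      by_contra hne
      exact disjoint_left.1 (hC hne) (hzB i).2 (hij ▸ (hzB j).2)
    have : (range z).ncard = k := by
      rw [← image_univ, ncard_image_of_injective _ hinj, ncard_univ, Nat.card_fin]
    rw [← this]
    refine ncard_le_ncard ?_ hfin
    rintro _ ⟨i, rfl⟩
    exact ⟨hz i, (hzB i).1⟩

variable [BorelSpace X] [T2Space X] [SecondCountableTopology X]

/-- The σ-algebra of the marked configuration space is generated by the void events. -/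
theorem generateFrom_voidSystem :
    (inferInstance : MeasurableSpace (MConf X)) = .generateFrom (voidSystem X) := by
  refine le_antisymm (iSup₂_le fun B hB => ?_) (MeasurableSpace.generateFrom_le ?_)
  · have hB' : RelCompact B := hB.2
    rw [← measurable_iff_comap_le]
    refine @measurable_nat_of_Ici _ (MeasurableSpace.generateFrom (voidSystem X)) _
      fun k => ?_
    have : count B ⁻¹' Ici k = ⋃ C : Fin k → TopologicalSpace.countableBasis (X × Mark),
        ⋃ _ : (Pairwise fun i j => Disjoint (C i : Set (X × Mark)) (C j)),
          ⋂ i, (voidSet (B ∩ (C i : Set (X × Mark))))ᶜ := by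
      ext ξ
      simp [le_count_iff hB']
    rw [this]
    have : Countable (TopologicalSpace.countableBasis (X × Mark)) :=
      (TopologicalSpace.countable_countableBasis _).to_subtype
    refine MeasurableSet.iUnion fun C => MeasurableSet.iUnion fun _ => MeasurableSet.iInter fun i =>
      MeasurableSet.compl (MeasurableSpace.measurableSet_generateFrom
        ⟨_, hB.1.inter ?_, hB'.mono inter_subset_left, rfl⟩)
    exact (TopologicalSpace.isOpen_of_mem_countableBasis (C i).2).measurableSet
  · rintro _ ⟨B, hB, hB', rfl⟩
    exact measurableSet_voidSet hB hB'

theorem measurable_of_voidSet {α : Type*} [MeasurableSpace α] {f : α → MConf X}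
    (hf : ∀ B, MeasurableSet B → RelCompact B → MeasurableSet (f ⁻¹' voidSet B)) :
    Measurable f := by
  have := measurable_generateFrom (f := f) (s := voidSystem X) (by
    rintro _ ⟨B, hB, hB', rfl⟩
    exact hf B hB hB')
  rwa [← generateFrom_voidSystem] at this

/-- Rényi's theorem: a law on the marked configuration space is determined by its void
probabilities. -/
theorem ext_of_voidSet {μ ν : Measure (MConf X)} [IsFiniteMeasure μ]
    (h : ∀ B, MeasurableSet B → RelCompact B → μ (voidSet B) = ν (voidSet B)) : μ = ν := by
  refine ext_of_generate_finite _ generateFrom_voidSystem isPiSystem_voidSystem ?_ ?_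
  · rintro _ ⟨B, hB, hB', rfl⟩
    exact h B hB hB'
  · have : (univ : Set (MConf X)) = voidSet ∅ := by
      ext ξ; simp [voidSet]
    rw [this]
    exact h ∅ .empty ⟨∅, isCompact_empty, by simp⟩

theorem measurable_restr {Λ : Set X} (hΛ : MeasurableSet Λ) : Measurable (restr Λ) := by
  refine measurable_of_voidSet fun B hB hB' => ?_
  rw [restr_preimage_voidSet]
  exact measurableSet_voidSet (hB.inter (hΛ.prod .univ)) (hB'.mono inter_subset_left)

/-- A void event depends only on the restriction to some large `Λ`, which may be enlarged to contain
`K`. With `K` a support of `g`, these are the `Λ` for which restriction commutes with `g`. -/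
theorem ext_of_map_restr {μ ν : Measure (MConf X)} [IsFiniteMeasure μ] (K : Set X)
    (hK : IsCompact K) [LocallyCompactSpace X]
    (h : ∀ Λ : Set X, IsOpen Λ → IsCompact (closure Λ) → K ⊆ Λ →
      μ.map (restr Λ) = ν.map (restr Λ)) : μ = ν := by
  refine ext_of_voidSet fun B hB hB' => ?_
  obtain ⟨L, hL, hBL⟩ := hB'
  obtain ⟨Λ, hΛ, hKL, hΛc⟩ := exists_isOpen_superset_and_isCompact_closure (hK.union hL)
  have h1 : restr Λ ⁻¹' voidSet B = voidSet B := by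
    rw [restr_preimage_voidSet, inter_eq_left.2]
    intro z hz
    exact ⟨hKL (.inr (hBL ⟨z, hz, rfl⟩)), mem_univ _⟩
  have h2 := measurableSet_voidSet hB ⟨L, hL, hBL⟩
  rw [← h1, ← Measure.map_apply (measurable_restr hΛ.measurableSet) h2,
    ← Measure.map_apply (measurable_restr hΛ.measurableSet) h2,
    h Λ hΛ hΛc (subset_union_left.trans hKL)]

theorem measurableSet_distinctTuples (n : ℕ) : MeasurableSet (distinctTuples X n) := by
  have : distinctTuples X n = ⋂ i, ⋂ j, ⋂ _ : i ≠ j, {z | (z i).1 = (z j).1}ᶜ := by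
    ext z
    simp only [distinctTuples, mem_ofPred_eq, mem_iInter, mem_compl_iff]
    exact ⟨fun h i j hij h' => hij (h h'), fun h i j h' => by_contra fun hij => h i j hij h'⟩
  rw [this]
  refine .iInter fun i => .iInter fun j => .iInter fun _ => (measurableSet_eq_fun ?_ ?_).compl
  · exact (measurable_pi_apply i).fst
  · exact (measurable_pi_apply j).fst

theorem ofTuple_val {n : ℕ} {z : Fin n → X × Mark} (hz : z ∈ distinctTuples X n) :
    (ofTuple n z).1 = range z := by
  exact congrArg Subtype.val (dif_pos hz : ofTuple n z = _)

theorem ofTuple_mem_voidSet {n : ℕ} {z : Fin n → X × Mark} (hz : z ∈ distinctTuples X n)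
    (B : Set (X × Mark)) : ofTuple n z ∈ voidSet B ↔ z ∈ univ.pi fun _ => Bᶜ := by
  simp [mem_voidSet, ofTuple_val hz]

theorem measurable_ofTuple (n : ℕ) : Measurable (ofTuple (X := X) n) := by
  refine measurable_of_voidSet fun B hB hB' => ?_
  -- Tuples with coinciding components go to the empty configuration, which lies in every void
  -- event.
  have : ofTuple n ⁻¹' voidSet B =
      (distinctTuples X n ∩ univ.pi fun _ => Bᶜ) ∪ (distinctTuples X n)ᶜ := by
    ext z
    by_cases hz : z ∈ distinctTuples X n
    · simp [hz, ofTuple_mem_voidSet hz]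
    · simp [hz, ofTuple, voidSet]
  rw [this]
  have hd := measurableSet_distinctTuples (X := X) n
  exact (hd.inter (.univ_pi fun _ => hB.compl)).union hd.compl

variable {d : ℕ} [ChartedSpace (Eu d) X]

theorem smul_mconf_val (g : MarkGroup d X) (ξ : MConf X) :
    (g • ξ).1 = (fun z => g • z) '' ξ.1 := rfl

theorem RelCompact.preimage_smul {B : Set (X × Mark)} (hB : RelCompact B) (g : MarkGroup d X) :
    RelCompact ((fun z => g • z) ⁻¹' B) := by
  obtain ⟨K, hK, hBK⟩ := hB
  refine ⟨_, hK.image g.contMDiff_diffeo_symm.continuous, ?_⟩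
  rintro _ ⟨z, hz, rfl⟩
  exact ⟨_, hBK ⟨_, hz, rfl⟩, g.diffeo.symm_apply_apply z.1⟩

theorem measurable_smul_mconf (g : MarkGroup d X) : Measurable fun ξ : MConf X => g • ξ := by
  refine measurable_of_voidSet fun B hB hB' => ?_
  have : (fun ξ : MConf X => g • ξ) ⁻¹' voidSet B = voidSet ((fun z => g • z) ⁻¹' B) := by
    ext ξ
    rw [mem_preimage, mem_voidSet, mem_voidSet, smul_mconf_val, forall_mem_image]
    rfl
  rw [this]
  exact measurableSet_voidSet (measurable_markGroup_smul g hB) (hB'.preimage_smul g)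

end ConfMeasurable

/-! ### Product measures, densities and the exponential series. -/

section Pi

variable {Y : Type*} [MeasurableSpace Y] (μ : Measure Y)

theorem lintegral_pi_prod [SigmaFinite μ] {n : ℕ} {f : Fin n → Y → ENNReal}
    (hf : ∀ i, Measurable (f i)) :
    ∫⁻ z, ∏ i, f i (z i) ∂Measure.pi (fun _ : Fin n => μ) = ∏ i, ∫⁻ y, f i y ∂μ := by
  induction n with
  | zero => simp
  | succ n ih =>
    have hm : Measurable fun z : Fin (n + 1) → Y => ∏ i, f i (z i) :=
      Finset.measurable_prod _ fun i _ => (hf i).comp (measurable_pi_apply i)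
    have hm' : Measurable fun z : Fin n → Y => ∏ i : Fin n, f i.succ (z i) :=
      Finset.measurable_prod _ fun i _ => (hf i.succ).comp (measurable_pi_apply i)
    rw [← ((measurePreserving_piFinSuccAbove (fun _ : Fin (n + 1) => μ) 0).symm).lintegral_comp hm]
    simp only [MeasurableEquiv.piFinSuccAbove_symm_apply, Fin.insertNthEquiv,
      Fin.prod_univ_succ, Fin.insertNth_zero, Equiv.coe_fn_mk, Fin.cons_succ,
      Fin.zero_succAbove, cast_eq, Fin.cons_zero]
    rw [lintegral_prod_mul (hf 0).aemeasurable hm'.aemeasurable, ih fun i => hf i.succ]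

theorem pi_withDensity [SigmaFinite μ] {f : Y → ENNReal} (hf : Measurable f)
    [SigmaFinite (μ.withDensity f)] (n : ℕ) :
    Measure.pi (fun _ : Fin n => μ.withDensity f) =
      (Measure.pi fun _ : Fin n => μ).withDensity fun z => ∏ i, f (z i) := by
  refine Measure.pi_eq fun s hs => ?_
  rw [withDensity_apply _ (.univ_pi hs), ← lintegral_indicator (.univ_pi hs)]
  have : ∀ z : Fin n → Y, (univ.pi s).indicator (fun z => ∏ i, f (z i)) z =
      ∏ i, (s i).indicator f (z i) := by
    intro z
    by_cases hz : z ∈ univ.pi s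
    · rw [indicator_of_mem hz]
      exact Finset.prod_congr rfl fun i _ => (indicator_of_mem (hz i (mem_univ i)) f).symm
    · rw [indicator_of_notMem hz]
      simp only [mem_pi, mem_univ, true_imp_iff, not_forall] at hz
      obtain ⟨i, hi⟩ := hz
      exact (Finset.prod_eq_zero (Finset.mem_univ i) (indicator_of_notMem hi f)).symm
  rw [lintegral_congr this, lintegral_pi_prod μ fun i => hf.indicator (hs i)]
  refine Finset.prod_congr rfl fun i _ => ?_
  rw [lintegral_indicator (hs i), withDensity_apply _ (hs i)]

/-- This serves to push a density through `ofTuple` and through `restr`, since the product of `p_g`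
factors through both. -/
theorem map_withDensity_comp {Z : Type*} [MeasurableSpace Z] {r : Y → Z} (hr : Measurable r)
    {F : Z → ENNReal} (hF : Measurable F) :
    (μ.withDensity (F ∘ r)).map r = (μ.map r).withDensity F := by
  ext S hS
  rw [Measure.map_apply hr hS, withDensity_apply _ (hr hS), withDensity_apply _ hS,
    setLIntegral_map hS hF hr]
  rfl

theorem tsum_inv_factorial_mul_pow {a : ENNReal} (ha : a ≠ ⊤) :
    ∑' n : ℕ, (n.factorial : ENNReal)⁻¹ * a ^ n = ENNReal.ofReal (Real.exp a.toReal) := by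
  rw [Real.exp_eq_exp_ℝ, NormedSpace.exp_eq_tsum_div,
    ENNReal.ofReal_tsum_of_nonneg (fun n => by positivity) (Real.summable_pow_div_factorial _)]
  refine tsum_congr fun n => ?_
  rw [ENNReal.ofReal_div_of_pos (by positivity), ENNReal.ofReal_pow ENNReal.toReal_nonneg,
    ENNReal.ofReal_toReal ha, ENNReal.ofReal_natCast, ENNReal.div_eq_inv_mul]

end Pi

/-! ### Poisson measures over a set of finite mass. -/

section LocalPoisson

variable {X : Type*} [TopologicalSpace X] [MeasurableSpace X] [BorelSpace X] [T2Space X]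
  [SecondCountableTopology X] {τ : Measure (X × Mark)}

/-- Integrating the `i`-th variable first, with the `j`-th fixed, leaves the measure of a fibre `{x}
× ℝ₊`, which is zero. -/
theorem pi_compl_distinctTuples {μ : Measure (X × Mark)} [SigmaFinite μ]
    (hμ : ∀ x, μ ({x} ×ˢ univ) = 0) (n : ℕ) :
    Measure.pi (fun _ : Fin n => μ) (distinctTuples X n)ᶜ = 0 := by
  have hsub : (distinctTuples X n)ᶜ ⊆ ⋃ i, ⋃ j, ⋃ _ : i ≠ j, {z | (z i).1 = (z j).1} := by
    intro z hz
    simp only [mem_compl_iff, distinctTuples, mem_ofPred_eq, Function.Injective, not_forall] at hz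
    obtain ⟨i, j, hij, hne⟩ := hz
    simp only [mem_iUnion]
    exact ⟨i, j, hne, hij⟩
  refine measure_mono_null hsub ?_
  refine measure_iUnion_null fun i => measure_iUnion_null fun j => measure_iUnion_null fun hij => ?_
  have hm : MeasurableSet {z : Fin n → X × Mark | (z i).1 = (z j).1} :=
    measurableSet_eq_fun (measurable_pi_apply i).fst (measurable_pi_apply j).fst
  rcases isEmpty_or_nonempty (Fin n → X × Mark) with h | ⟨⟨x⟩⟩
  · rw [Subsingleton.elim {z : Fin n → X × Mark | (z i).1 = (z j).1} ∅, measure_empty]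
  have hf : Measurable ({z : Fin n → X × Mark | (z i).1 = (z j).1}.indicator
      (1 : (Fin n → X × Mark) → ENNReal)) := measurable_one.indicator hm
  rw [← lintegral_indicator_one hm, lintegral_eq_lmarginal_univ x,
    lmarginal_erase' _ hf (Finset.mem_univ i)]
  have h0 : ∀ z : Fin n → X × Mark, ∫⁻ y, {z : Fin n → X × Mark | (z i).1 = (z j).1}.indicator
      (1 : (Fin n → X × Mark) → ENNReal) (Function.update z i y) ∂μ = 0 := by
    intro z
    have h1 : ∀ y, {z : Fin n → X × Mark | (z i).1 = (z j).1}.indicator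
        (1 : (Fin n → X × Mark) → ENNReal) (Function.update z i y) =
        (({(z j).1} : Set X) ×ˢ (univ : Set Mark)).indicator 1 y := by
      intro y
      have hy : Function.update z i y ∈ {z : Fin n → X × Mark | (z i).1 = (z j).1} ↔
          y ∈ ({(z j).1} : Set X) ×ˢ (univ : Set Mark) := by
        rw [mem_ofPred_eq, Function.update_self, Function.update_of_ne hij.symm]
        simp
      by_cases h : y ∈ ({(z j).1} : Set X) ×ˢ (univ : Set Mark)
      · rw [indicator_of_mem h, indicator_of_mem (hy.2 h)]
        rfl
      · rw [indicator_of_notMem h, indicator_of_notMem (fun h' => h (hy.1 h'))]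
    rw [lintegral_congr h1, lintegral_indicator_one
      ((measurableSet_singleton _).prod .univ), hμ]
  simp [h0, lmarginal]

theorem localPoisson_apply (τ : Measure (X × Mark)) (A : Set X) {S : Set (MConf X)}
    (hS : MeasurableSet S) :
    localPoisson τ A S = ENNReal.ofReal (Real.exp (-(τ (A ×ˢ univ)).toReal)) *
      ∑' n : ℕ, (n.factorial : ENNReal)⁻¹ *
        Measure.pi (fun _ : Fin n => τ.restrict (A ×ˢ univ))
          (ofTuple n ⁻¹' S ∩ distinctTuples X n) := by
  rw [localPoisson, Measure.smul_apply, Measure.sum_apply _ hS, smul_eq_mul]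
  congr 1
  refine tsum_congr fun n => ?_
  rw [Measure.smul_apply, Measure.map_apply (measurable_ofTuple n) hS,
    Measure.restrict_apply (measurable_ofTuple n hS), smul_eq_mul]

/-- The void probabilities of a Poisson measure. -/
theorem localPoisson_voidSet (hτ : ∀ x, τ ({x} ×ˢ univ) = 0) {A : Set X}
    (hAτ : τ (A ×ˢ univ) ≠ ⊤) {B : Set (X × Mark)} (hB : MeasurableSet B) (hB' : RelCompact B) :
    localPoisson τ A (voidSet B) =
      ENNReal.ofReal (Real.exp (-(τ (B ∩ A ×ˢ univ)).toReal)) := by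
  have hfin : IsFiniteMeasure (τ.restrict (A ×ˢ (univ : Set Mark))) :=
    ⟨by rw [Measure.restrict_apply_univ]; exact hAτ.lt_top⟩
  have hnull := pi_compl_distinctTuples (μ := τ.restrict (A ×ˢ (univ : Set Mark))) fun x =>
    le_antisymm ((Measure.restrict_apply_le _ _).trans (hτ x).le) zero_le
  have h1 : ∀ n, Measure.pi (fun _ : Fin n => τ.restrict (A ×ˢ (univ : Set Mark)))
      (ofTuple n ⁻¹' voidSet B ∩ distinctTuples X n) = τ.restrict (A ×ˢ univ) Bᶜ ^ n := by
    intro n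
    have : ofTuple n ⁻¹' voidSet B ∩ distinctTuples X n =
        (univ.pi fun _ => Bᶜ) ∩ distinctTuples X n := by
      ext z
      simp only [mem_inter_iff, mem_preimage]
      exact and_congr_left fun hz => ofTuple_mem_voidSet hz B
    rw [this, measure_inter_conull (hnull n), Measure.pi_pi]
    simp
  rw [localPoisson_apply τ A (measurableSet_voidSet hB hB')]
  simp_rw [h1]
  -- The series sums to `exp (τ (A × ℝ₊ \ B))`. With the prefactor, additivity of `τ` leaves the
  -- exponent `-τ (B ∩ A × ℝ₊)`.
  rw [tsum_inv_factorial_mul_pow (measure_ne_top _ _), ← ENNReal.ofReal_mul (Real.exp_pos _).le,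
    ← Real.exp_add]
  congr 2
  have hBc := measure_inter_add_sdiff (μ := τ) (A ×ˢ (univ : Set Mark)) hB
  have e1 : τ ((A ×ˢ univ) ∩ B) ≠ ⊤ := measure_ne_top_of_subset inter_subset_left hAτ
  have e2 : τ ((A ×ˢ univ) \ B) ≠ ⊤ := measure_ne_top_of_subset sdiff_subset hAτ
  rw [Measure.restrict_apply hB.compl, ← hBc, ENNReal.toReal_add e1 e2, inter_comm B,
    inter_comm Bᶜ, ← sdiff_eq]
  ring

theorem isProbabilityMeasure_localPoisson (hτ : ∀ x, τ ({x} ×ˢ univ) = 0) {A : Set X}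
    (hAτ : τ (A ×ˢ univ) ≠ ⊤) :
    IsProbabilityMeasure (localPoisson τ A) := by
  refine ⟨?_⟩
  have : (univ : Set (MConf X)) = voidSet ∅ := by
    ext ξ; simp [voidSet]
  rw [this, localPoisson_voidSet hτ hAτ .empty ⟨∅, isCompact_empty, by simp⟩]
  simp

end LocalPoisson

/-! ### Uniqueness and existence of the marked Poisson measure. -/

section Poisson

variable {X : Type*} [TopologicalSpace X] [MeasurableSpace X] [BorelSpace X] [T2Space X]
  [SecondCountableTopology X] [LocallyCompactSpace X] {τ : Measure (X × Mark)}

theorem RelCompact.measure_ne_top (hτK : ∀ K : Set X, IsCompact K → τ (K ×ˢ univ) < ⊤)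
    {B : Set (X × Mark)} (hB : RelCompact B) : τ B ≠ ⊤ := by
  obtain ⟨K, hK, hBK⟩ := hB
  have hsub : B ⊆ K ×ˢ univ := fun z hz => ⟨hBK ⟨z, hz, rfl⟩, mem_univ _⟩
  exact measure_ne_top_of_subset hsub (hτK K hK).ne

theorem IsMarkedPoisson.voidSet {π : Measure (MConf X)} (hπ : IsMarkedPoisson τ π)
    (hτ : ∀ x, τ ({x} ×ˢ univ) = 0) (hτK : ∀ K : Set X, IsCompact K → τ (K ×ˢ univ) < ⊤)
    {B : Set (X × Mark)} (hB : MeasurableSet B) (hB' : RelCompact B) :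
    π (voidSet B) = ENNReal.ofReal (Real.exp (-(τ B).toReal)) := by
  obtain ⟨K, hK, hBK⟩ := id hB'
  obtain ⟨Λ, hΛ, hKΛ, hΛc⟩ := exists_isOpen_superset_and_isCompact_closure hK
  have h1 : B ∩ Λ ×ˢ univ = B :=
    inter_eq_left.2 fun z hz => ⟨hKΛ (hBK ⟨z, hz, rfl⟩), mem_univ _⟩
  have hΛτ : τ (Λ ×ˢ univ) ≠ ⊤ :=
    ((relCompact_prod hΛc).mono (prod_mono_left subset_closure)).measure_ne_top hτK
  have h2 := localPoisson_voidSet hτ hΛτ hB hB'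
  rwa [← hπ.2 Λ hΛ hΛc, Measure.map_apply (measurable_restr hΛ.measurableSet)
    (measurableSet_voidSet hB hB'), restr_preimage_voidSet, h1] at h2

theorem IsMarkedPoisson.unique {π π' : Measure (MConf X)} (hπ : IsMarkedPoisson τ π)
    (hπ' : IsMarkedPoisson τ π') (hτ : ∀ x, τ ({x} ×ˢ univ) = 0)
    (hτK : ∀ K : Set X, IsCompact K → τ (K ×ˢ univ) < ⊤) : π = π' := by
  have := hπ.1
  refine ext_of_voidSet fun B hB hB' => ?_
  rw [hπ.voidSet hτ hτK hB hB', hπ'.voidSet hτ hτK hB hB']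

/-- The image under `restr Λ` and the local Poisson measure have the same void probabilities.
Existence thus reduces to producing the correct void probabilities. -/
theorem isMarkedPoisson_of_voidSet {π : Measure (MConf X)} [IsProbabilityMeasure π]
    (hτ : ∀ x, τ ({x} ×ˢ univ) = 0) (hτK : ∀ K : Set X, IsCompact K → τ (K ×ˢ univ) < ⊤)
    (h : ∀ B, MeasurableSet B → RelCompact B →
      π (MarkedConf.voidSet B) = ENNReal.ofReal (Real.exp (-(τ B).toReal))) :
    IsMarkedPoisson τ π := by
  refine ⟨inferInstance, fun Λ hΛ hΛc => ext_of_voidSet fun B hB hB' => ?_⟩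
  have hΛτ : τ (Λ ×ˢ univ) ≠ ⊤ :=
    ((relCompact_prod hΛc).mono (prod_mono_left subset_closure)).measure_ne_top hτK
  rw [localPoisson_voidSet hτ hΛτ hB hB',
    Measure.map_apply (measurable_restr hΛ.measurableSet) (measurableSet_voidSet hB hB'),
    restr_preimage_voidSet]
  exact h _ (hB.inter (hΛ.measurableSet.prod .univ)) (hB'.mono inter_subset_left)

variable (X) in
/-- A partition of `X` into measurable layers, of which each compact set meets only finitely
many. -/
theorem exists_layers : ∃ A : ℕ → Set X, (∀ k, MeasurableSet (A k)) ∧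
    (∀ k, ∃ K, IsCompact K ∧ A k ⊆ K) ∧ Pairwise (Function.onFun Disjoint A) ∧
    ⋃ k, A k = univ ∧ ∀ K : Set X, IsCompact K → ∃ n, ∀ k, n ≤ k → Disjoint (A k) K := by
  let E := CompactExhaustion.choice X
  refine ⟨disjointed E, fun k => .disjointed (fun n => (E.isCompact n).measurableSet) k,
    fun k => ⟨E k, E.isCompact k, disjointed_subset _ k⟩, disjoint_disjointed _,
    by rw [iUnion_disjointed, E.iUnion_eq], fun K hK => ?_⟩
  obtain ⟨n, hn⟩ := E.exists_superset_of_isCompact hK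
  -- The layer `k` is `E k` minus all earlier sets, so it avoids `E n ⊇ K` only from `k = n + 1` on.
  refine ⟨n + 1, fun k hk => ?_⟩
  have h1 : Disjoint (disjointed E k) (E n) := by
    obtain ⟨j, rfl⟩ : ∃ j, k = j + 1 := ⟨k - 1, by omega⟩
    rw [← Order.succ_eq_add_one, disjointed_succ _ (not_isMax j)]
    exact disjoint_sdiff_left.mono_right (le_partialSups_of_le E (by omega))
  exact h1.mono_right hn

/-- The configuration that coincides with `ξ k` on the layer `A k`. -/
def glue {A : ℕ → Set X} (hd : Pairwise (Function.onFun Disjoint A))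
    (hK : ∀ K : Set X, IsCompact K → ∃ n, ∀ k, n ≤ k → Disjoint (A k) K)
    (ξ : ℕ → MConf X) : MConf X :=
  ⟨⋃ k, (ξ k).1 ∩ A k ×ˢ univ, by
    constructor
    · intro z hz w hw hzw
      obtain ⟨i, hzi⟩ := mem_iUnion.1 hz
      obtain ⟨j, hwj⟩ := mem_iUnion.1 hw
      have hij : i = j := by
        by_contra hne
        exact disjoint_left.1 (hd hne) hzi.2.1 (hzw ▸ hwj.2.1)
      subst hij
      exact (ξ i).2.1 hzi.1 hwj.1 hzw
    · intro K hKc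
      obtain ⟨n, hn⟩ := hK K hKc
      refine ((finite_Iio n).biUnion fun k _ => (ξ k).2.2 K hKc).subset ?_
      rintro _ ⟨⟨z, hz, rfl⟩, hzK⟩
      obtain ⟨k, hk⟩ := mem_iUnion.1 hz
      refine mem_biUnion (x := k) ?_ ⟨⟨z, hk.1, rfl⟩, hzK⟩
      by_contra hkn
      exact disjoint_left.1 (hn k (not_lt.1 hkn)) hk.2.1 hzK⟩

/-- Only the first `n` layers meet `B`, so the event is a finite-dimensional cylinder. -/
theorem glue_preimage_voidSet {A : ℕ → Set X} (hd : Pairwise (Function.onFun Disjoint A))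
    (hK : ∀ K : Set X, IsCompact K → ∃ n, ∀ k, n ≤ k → Disjoint (A k) K) {B : Set (X × Mark)}
    {n : ℕ} (hn : ∀ k, n ≤ k → B ∩ A k ×ˢ univ = ∅) :
    glue hd hK ⁻¹' voidSet B =
      (Finset.range n : Set ℕ).pi fun k => voidSet (B ∩ A k ×ˢ univ) := by
  ext ξ
  have hval : (glue hd hK ξ).1 = ⋃ k, (ξ k).1 ∩ A k ×ˢ univ := rfl
  simp only [mem_preimage, mem_voidSet, hval, mem_iUnion, mem_pi]
  constructor
  · exact fun h k _ z hz hzB => h z ⟨k, hz, hzB.2⟩ hzB.1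
  · rintro h z ⟨k, hz, hzA⟩ hzB
    rcases lt_or_ge k n with hkn | hkn
    · exact h k (by simpa using hkn) z hz ⟨hzB, hzA⟩
    · exact (hn k hkn).subset ⟨hzB, hzA⟩

/-- Independent Poisson configurations on disjoint layers are glued. The probability of a void event
is a finite product of exponentials, whose exponents add up to `-τ B` by additivity. -/
theorem exists_isMarkedPoisson (hτ : ∀ x, τ ({x} ×ˢ univ) = 0)
    (hτK : ∀ K : Set X, IsCompact K → τ (K ×ˢ univ) < ⊤) :
    ∃ π : Measure (MConf X), IsMarkedPoisson τ π := by
  obtain ⟨A, hA, hAK, hd, hu, hK⟩ := exists_layers X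
  have hAτ : ∀ k, τ (A k ×ˢ univ) ≠ ⊤ := fun k => by
    obtain ⟨K, hKc, hAk⟩ := hAK k
    exact ((relCompact_prod hKc).mono (prod_mono_left hAk)).measure_ne_top hτK
  have hP := fun k => isProbabilityMeasure_localPoisson hτ (hAτ k)
  have hn : ∀ B : Set (X × Mark), RelCompact B →
      ∃ n, ∀ k, n ≤ k → B ∩ A k ×ˢ univ = ∅ := by
    rintro B ⟨K, hKc, hBK⟩
    obtain ⟨n, hn⟩ := hK K hKc
    refine ⟨n, fun k hk => ?_⟩
    rw [← disjoint_iff_inter_eq_empty, disjoint_left]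
    exact fun z hz hzA => disjoint_left.1 (hn k hk) hzA.1 (hBK ⟨z, hz, rfl⟩)
  have hBm : ∀ {B : Set (X × Mark)}, MeasurableSet B → RelCompact B → ∀ k,
      MeasurableSet (voidSet (B ∩ A k ×ˢ univ)) := fun hB hB' k =>
    measurableSet_voidSet (hB.inter ((hA k).prod .univ)) (hB'.mono inter_subset_left)
  have hglue : Measurable (glue hd hK) := by
    refine measurable_of_voidSet fun B hB hB' => ?_
    obtain ⟨n, hn⟩ := hn B hB'
    rw [glue_preimage_voidSet hd hK hn]
    exact MeasurableSet.pi (Finset.countable_toSet _) fun k _ => hBm hB hB' k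
  have : IsProbabilityMeasure ((Measure.infinitePi fun k => localPoisson τ (A k)).map
      (glue hd hK)) := Measure.isProbabilityMeasure_map hglue.aemeasurable
  refine ⟨(Measure.infinitePi fun k => localPoisson τ (A k)).map (glue hd hK),
    isMarkedPoisson_of_voidSet hτ hτK fun B hB hB' => ?_⟩
  obtain ⟨n, hn⟩ := hn B hB'
  rw [Measure.map_apply hglue (measurableSet_voidSet hB hB'), glue_preimage_voidSet hd hK hn,
    Measure.infinitePi_pi _ fun k _ => hBm hB hB' k]
  have h1 : ∀ k, localPoisson τ (A k) (voidSet (B ∩ A k ×ˢ univ)) =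
      ENNReal.ofReal (Real.exp (-(τ (B ∩ A k ×ˢ univ)).toReal)) := by
    intro k
    rw [localPoisson_voidSet hτ (hAτ k) (hB.inter ((hA k).prod .univ))
      (hB'.mono inter_subset_left), inter_assoc, inter_self]
  simp_rw [h1]
  rw [← ENNReal.ofReal_prod_of_nonneg fun _ _ => (Real.exp_pos _).le, ← Real.exp_sum,
    Finset.sum_neg_distrib, ← ENNReal.toReal_sum fun k _ =>
      (hB'.mono inter_subset_left).measure_ne_top hτK]
  congr 4
  have hunion : B = ⋃ k ∈ Finset.range n, B ∩ A k ×ˢ univ := by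
    refine Subset.antisymm (fun z hz => ?_) (iUnion₂_subset fun k _ => inter_subset_left)
    obtain ⟨k, hk⟩ := mem_iUnion.1 (hu.symm ▸ mem_univ z.1 : z.1 ∈ ⋃ k, A k)
    refine mem_biUnion (x := k) ?_ ⟨hz, hk, mem_univ _⟩
    by_contra hkn
    exact (hn k (by simpa using hkn)).subset ⟨hz, hk, mem_univ _⟩
  conv_rhs => rw [hunion]
  refine (measure_biUnion_finset (fun i _ j _ hij => ?_) fun k _ =>
    hB.inter ((hA k).prod .univ)).symm
  exact disjoint_left.2 fun z hz hz' => disjoint_left.1 (hd hij) hz.2.1 hz'.2.1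

end Poisson

/-! ### Measurability and positivity of the product over a configuration. -/

section ProductFunctional

variable {X : Type*} [TopologicalSpace X] [MeasurableSpace X] [BorelSpace X] [T2Space X]
  [SecondCountableTopology X]

/-- Grouping the points by the value `c` of `s` turns the product into `∏ c ^ N` with `N` a counting
function. -/
theorem measurable_prod_simpleFunc {C : Set (X × Mark)} (hC : MeasurableSet C)
    (hC' : RelCompact C) (s : SimpleFunc (X × Mark) ENNReal) :
    Measurable fun ξ : MConf X => ∏ z ∈ (hC'.finite_inter ξ).toFinset, s z := by
  classical
  have : ∀ ξ : MConf X, ∏ z ∈ (hC'.finite_inter ξ).toFinset, s z =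
      ∏ c ∈ s.range, c ^ count (C ∩ s ⁻¹' {c}) ξ := by
    intro ξ
    rw [← Finset.prod_fiberwise_of_maps_to' (t := s.range) (fun z _ => s.mem_range_self z)
      fun c => c]
    refine Finset.prod_congr rfl fun c _ => ?_
    rw [Finset.prod_const, count, ← ncard_coe_finset]
    congr 2
    ext z
    simp only [Finset.coe_filter, Finite.mem_toFinset, mem_ofPred_eq, mem_inter_iff, mem_preimage,
      mem_singleton_iff, and_assoc]
  rw [funext this]
  exact Finset.measurable_prod _ fun c _ => measurable_const.pow (measurable_count
    (hC.inter (s.measurableSet_preimage _)) (hC'.mono inter_subset_left))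

/-- Only the finitely many points of `ξ` in `C` contribute, so `∏ᶠ` is a genuine product here and
not the default value `1`. -/
theorem finprod_mem_eq_of_support {C : Set (X × Mark)} (hC' : RelCompact C) {u : X × Mark → ENNReal}
    (hu1 : ∀ z ∉ C, u z = 1) (ξ : MConf X) :
    ∏ᶠ z ∈ ξ.1, u z = ∏ z ∈ (hC'.finite_inter ξ).toFinset, u z := by
  refine finprod_mem_eq_prod_of_inter_mulSupport_eq _ ?_
  ext z
  have : z ∈ Function.mulSupport u → z ∈ C := fun h => by_contra fun h' => h (hu1 z h')
  simp only [mem_inter_iff, Finite.coe_toFinset]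
  tauto

/-- Simple functions approximate `u` pointwise, and finite products converge because the limits of
the factors are finite. The approximants need not equal `1` off `C`, so the product is first
confined to `C`. -/
theorem measurable_finprod_mem {C : Set (X × Mark)} (hC : MeasurableSet C) (hC' : RelCompact C)
    {u : X × Mark → ENNReal} (hu : Measurable u) (hu_top : ∀ z, u z ≠ ⊤)
    (hu1 : ∀ z ∉ C, u z = 1) : Measurable fun ξ : MConf X => ∏ᶠ z ∈ ξ.1, u z := by
  rw [funext fun ξ => finprod_mem_eq_of_support hC' hu1 ξ]
  refine measurable_of_tendsto_metrizable (fun n : ℕ => measurable_prod_simpleFunc hC hC'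
    (SimpleFunc.eapprox u n)) (tendsto_pi_nhds.2 fun ξ => ?_)
  exact ENNReal.tendsto_finsetProd_of_ne_top _ (fun z _ => SimpleFunc.tendsto_eapprox hu z)
    fun z _ => hu_top z

theorem finprod_mem_ne_zero {C : Set (X × Mark)} (hC' : RelCompact C)
    {u : X × Mark → ENNReal} (hu0 : ∀ z, u z ≠ 0) (hu1 : ∀ z ∉ C, u z = 1) (ξ : MConf X) :
    ∏ᶠ z ∈ ξ.1, u z ≠ 0 := by
  rw [finprod_mem_eq_of_support hC' hu1 ξ]
  exact Finset.prod_ne_zero_iff.2 fun z _ => hu0 z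

end ProductFunctional

/-! ### Transformation of Poisson measures under the group. -/

section QuasiInvariance

variable {X : Type*} [TopologicalSpace X] [MeasurableSpace X] [BorelSpace X] [T2Space X]
  [SecondCountableTopology X] {τ : Measure (X × Mark)} {d : ℕ} [ChartedSpace (Eu d) X]

theorem smul_mem_distinctTuples_iff (g : MarkGroup d X) {n : ℕ} (z : Fin n → X × Mark) :
    (fun i => g • z i) ∈ distinctTuples X n ↔ z ∈ distinctTuples X n :=
  ⟨fun h _ _ hij => h (congrArg g.diffeo hij), fun h => g.diffeo.injective.comp h⟩

theorem smul_ofTuple (g : MarkGroup d X) {n : ℕ} (z : Fin n → X × Mark) :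
    g • ofTuple n z = ofTuple n fun i => g • z i := by
  refine Subtype.ext ?_
  by_cases hz : z ∈ distinctTuples X n
  · rw [ofTuple_val ((smul_mem_distinctTuples_iff g z).2 hz), smul_mconf_val, ofTuple_val hz,
      ← range_comp]
    rfl
  · have hz' := fun h => hz ((smul_mem_distinctTuples_iff g z).1 h)
    rw [smul_mconf_val, show ofTuple n z = _ from dif_neg hz,
      show ofTuple n (fun i => g • z i) = _ from dif_neg hz']
    exact image_empty _

/-- A bijection that is the identity off `K` permutes every set containing `K`. -/
theorem smul_mem_prod_iff (g : MarkGroup d X) {K Λ : Set X} (hg : ∀ x ∉ K, g.diffeo x = x)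
    (hK : K ⊆ Λ) (z : X × Mark) : g • z ∈ Λ ×ˢ (univ : Set Mark) ↔ z ∈ Λ ×ˢ (univ : Set Mark) := by
  simp only [mem_prod, mem_univ, and_true, MarkGroup.smul_def]
  by_cases hz : z.1 ∈ K
  · refine iff_of_true (by_contra fun hΛ => ?_) (hK hz)
    have h1 := hg _ fun h => hΛ (hK h)
    rw [g.diffeo.injective h1] at hΛ
    exact hΛ (hK hz)
  · rw [hg _ hz]

theorem restr_smul (g : MarkGroup d X) {K Λ : Set X} (hg : ∀ x ∉ K, g.diffeo x = x)
    (hK : K ⊆ Λ) (ξ : MConf X) : restr Λ (g • ξ) = g • restr Λ ξ := by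
  refine Subtype.ext ?_
  rw [restr_val, smul_mconf_val, smul_mconf_val, restr_val, ← image_inter_preimage]
  congr 2
  ext z
  exact smul_mem_prod_iff g hg hK z

/-- The group acts on tuples coordinatewise, so the image of the product measure has the density `∏
u (z i)`. On tuples with distinct components this is the product over the configuration and survives
the passage to sets. -/
theorem map_smul_localPoisson (g : MarkGroup d X) {K Λ : Set X} (hg : ∀ x ∉ K, g.diffeo x = x)
    (hK : K ⊆ Λ) (hΛ : MeasurableSet Λ) (hΛτ : τ (Λ ×ˢ univ) ≠ ⊤) {u : X × Mark → ENNReal}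
    (hu : Measurable u) (hτg : τ.map (fun z => g • z) = τ.withDensity u)
    (hF : Measurable fun ξ : MConf X => ∏ᶠ z ∈ ξ.1, u z) :
    (localPoisson τ Λ).map (fun ξ => g • ξ) =
      (localPoisson τ Λ).withDensity fun ξ => ∏ᶠ z ∈ ξ.1, u z := by
  set μ := τ.restrict (Λ ×ˢ (univ : Set Mark)) with hμ
  have hgm := measurable_markGroup_smul g
  have hΛm : MeasurableSet (Λ ×ˢ (univ : Set Mark)) := hΛ.prod .univ
  have hμfin : IsFiniteMeasure μ := ⟨by rw [hμ, Measure.restrict_apply_univ]; exact hΛτ.lt_top⟩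
  have hμg : μ.map (fun z => g • z) = μ.withDensity u := by
    have hpre : (fun z => g • z) ⁻¹' (Λ ×ˢ (univ : Set Mark)) = Λ ×ˢ (univ : Set Mark) := by
      ext z
      exact smul_mem_prod_iff g hg hK z
    rw [hμ, ← restrict_withDensity hΛm, ← hτg, Measure.restrict_map hgm hΛm, hpre]
  have hfin : IsFiniteMeasure (μ.withDensity u) := by
    rw [← hμg]; infer_instance
  have htuple : ∀ n, Measurable fun (z : Fin n → X × Mark) i => g • z i := fun n =>
    measurable_pi_lambda _ fun i => hgm.comp (measurable_pi_apply i)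
  have hn : ∀ n, (((Measure.pi fun _ : Fin n => μ).restrict (distinctTuples X n)).map
      (ofTuple n)).map (fun ξ => g • ξ) =
      (((Measure.pi fun _ : Fin n => μ).restrict (distinctTuples X n)).map
        (ofTuple n)).withDensity fun ξ => ∏ᶠ z ∈ ξ.1, u z := by
    intro n
    have hpre : (fun (z : Fin n → X × Mark) i => g • z i) ⁻¹' distinctTuples X n =
        distinctTuples X n := ext fun z => smul_mem_distinctTuples_iff g z
    have hpi : (Measure.pi fun _ : Fin n => μ).map (fun z i => g • z i) =
        (Measure.pi fun _ : Fin n => μ).withDensity fun z => ∏ i, u (z i) := by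
      have : ∀ _ : Fin n, SigmaFinite (μ.map fun z => g • z) := fun _ => inferInstance
      rw [Measure.pi_map_pi fun _ => hgm.aemeasurable, hμg, pi_withDensity μ hu n]
    have hd := measurableSet_distinctTuples (X := X) n
    rw [Measure.map_map (measurable_smul_mconf g) (measurable_ofTuple n),
      show (fun ξ : MConf X => g • ξ) ∘ ofTuple n =
        ofTuple n ∘ fun (z : Fin n → X × Mark) i => g • z i from funext fun z => smul_ofTuple g z,
      ← Measure.map_map (measurable_ofTuple n) (htuple n)]
    conv_lhs => rw [← hpre, ← Measure.restrict_map (htuple n) hd, hpi, restrict_withDensity hd]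
    rw [← map_withDensity_comp _ (measurable_ofTuple n) hF]
    congr 1
    refine withDensity_congr_ae ?_
    filter_upwards [ae_restrict_mem hd] with z hz
    rw [Function.comp_apply, ofTuple_val hz,
      finprod_mem_range (fun i j hij => hz (congrArg Prod.fst hij)), finprod_eq_prod_of_fintype]
  -- The same factors `exp (-τ (Λ × ℝ₊))` and `1/n!` stand on both sides, so the identity for each
  -- `n` suffices.
  rw [localPoisson, Measure.map_smul, withDensity_smul_measure,
    Measure.map_sum (measurable_smul_mconf g).aemeasurable, withDensity_sum]
  congr 2
  funext n
  rw [Measure.map_smul, withDensity_smul_measure, hn]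

theorem finprod_mem_restr {K Λ : Set X} (hK : K ⊆ Λ) {u : X × Mark → ENNReal}
    (hu1 : ∀ z : X × Mark, z.1 ∉ K → u z = 1) (ξ : MConf X) :
    ∏ᶠ z ∈ (restr Λ ξ).1, u z = ∏ᶠ z ∈ ξ.1, u z := by
  refine finprod_mem_inter_mulSupport_eq' _ _ _ fun z hz => ?_
  rw [restr_val]
  exact and_iff_left ⟨hK (by_contra fun h => hz (hu1 z h)), mem_univ _⟩

/-- For `Λ ⊇ K` both the action of `g` and the product of `u` are compatible with restriction to
`Λ`, which reduces the claim to `map_smul_localPoisson`. -/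
theorem IsMarkedPoisson.map_smul [LocallyCompactSpace X] {π : Measure (MConf X)}
    (hπ : IsMarkedPoisson τ π) (hτK : ∀ K : Set X, IsCompact K → τ (K ×ˢ univ) < ⊤)
    (g : MarkGroup d X) {K : Set X} (hKc : IsCompact K) (hg : ∀ x ∉ K, g.diffeo x = x)
    {u : X × Mark → ENNReal} (hu : Measurable u) (hu_top : ∀ z, u z ≠ ⊤)
    (hu1 : ∀ z : X × Mark, z.1 ∉ K → u z = 1)
    (hτg : τ.map (fun z => g • z) = τ.withDensity u) :
    π.map (fun ξ => g • ξ) = π.withDensity fun ξ => ∏ᶠ z ∈ ξ.1, u z := by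
  have := hπ.1
  have hF : Measurable fun ξ : MConf X => ∏ᶠ z ∈ ξ.1, u z :=
    measurable_finprod_mem (hKc.measurableSet.prod .univ) (relCompact_prod hKc) hu hu_top
      fun z hz => hu1 z fun h => hz ⟨h, mem_univ _⟩
  refine ext_of_map_restr K hKc fun Λ hΛ hΛc hK => ?_
  have hr := measurable_restr hΛ.measurableSet
  have hgm : Measurable fun ξ : MConf X => g • ξ := measurable_smul_mconf g
  have hΛτ : τ (Λ ×ˢ univ) ≠ ⊤ :=
    ((relCompact_prod hΛc).mono (prod_mono_left subset_closure)).measure_ne_top hτK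
  have hFr : (fun ξ : MConf X => ∏ᶠ z ∈ ξ.1, u z) =
      (fun ξ : MConf X => ∏ᶠ z ∈ ξ.1, u z) ∘ restr Λ :=
    funext fun ξ => (finprod_mem_restr hK hu1 ξ).symm
  rw [Measure.map_map hr hgm, show restr Λ ∘ (fun ξ : MConf X => g • ξ) =
    (fun ξ => g • ξ) ∘ restr Λ from funext fun ξ => restr_smul g hg hK ξ,
    ← Measure.map_map hgm hr, hπ.2 Λ hΛ hΛc,
    map_smul_localPoisson g hg hK hΛ.measurableSet hΛτ hu hτg hF]
  conv_rhs => rw [hFr, map_withDensity_comp _ hr hF, hπ.2 Λ hΛ hΛc]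

end QuasiInvariance

/-! ### Diffuseness of the Lévy measure. -/

section Levy

variable {d : ℕ} {X : Type*} [TopologicalSpace X] [ChartedSpace (Eu d) X]
  [IsManifold (𝓡 d) ∞ X] [T2Space X] [SecondCountableTopology X]
  [MeasurableSpace X] [BorelSpace X]

variable (d X) in
-- In dimension zero a connected manifold is discrete, hence one point, hence compact.
theorem nontrivial_model [ConnectedSpace X] [NoncompactSpace X] : Nontrivial (Eu d) := by
  by_contra h
  rw [not_nontrivial_iff_subsingleton] at h
  have : DiscreteTopology X := ChartedSpace.discreteTopology (Eu d) X
  have : Subsingleton X := PreconnectedSpace.trivial_of_discrete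
  exact noncompact_univ X (subsingleton_univ.isCompact)

theorem levyMeasure_fiber [Nonempty X] [Nontrivial (Eu d)] (h : RMetric d X) (ρ : X → ENNReal)
    (p : X → Mark → ENNReal) (x : X) : levyMeasure h ρ p ({x} ×ˢ univ) = 0 := by
  refine withDensity_absolutelyContinuous _ _ ?_
  have := sFinite_riemVolume h
  rw [Measure.prod_prod, riemVolume_singleton, zero_mul]

end Levy
end

end MarkedConf

theorem proposition2p3 {d : ℕ} {X : Type*} [TopologicalSpace X] [ChartedSpace (MarkedConf.Eu d) X]
    [IsManifold (𝓡 d) ∞ X] [T2Space X] [SecondCountableTopology X]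
    [ConnectedSpace X] [NoncompactSpace X] [MeasurableSpace X] [BorelSpace X]
    (h : MarkedConf.RMetric d X)
    (ρ : X → ENNReal) (hρ : Measurable ρ)
    (hρ_pos : ∀ᵐ x ∂(MarkedConf.riemVolume h), 0 < ρ x)
    (hρ_fin : ∀ K : Set X, IsCompact K → ((MarkedConf.riemVolume h).withDensity ρ) K < ⊤)
    (p : X → MarkedConf.Mark → ENNReal) (hp : Measurable (Function.uncurry p))
    (hp_pos : ∀ᵐ x ∂(MarkedConf.riemVolume h), ∀ᵐ s ∂MarkedConf.markLebesgue, 0 < p x s)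
    (hfin : ∀ K : Set X, IsCompact K → MarkedConf.levyMeasure h ρ p (K ×ˢ univ) < ⊤) :
    (∃! π : Measure (MarkedConf.MConf X),
      MarkedConf.IsMarkedPoisson (MarkedConf.levyMeasure h ρ p) π) ∧
    ∀ π : Measure (MarkedConf.MConf X),
      MarkedConf.IsMarkedPoisson (MarkedConf.levyMeasure h ρ p) π →
      ∀ g : MarkedConf.MarkGroup d X,
        ((MarkedConf.levyMeasure h ρ p).map (fun z => g • z) =
          (MarkedConf.levyMeasure h ρ p).withDensity (MarkedConf.groupDensity h ρ p g)) ∧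
        Measurable (fun ξ : MarkedConf.MConf X => g • ξ) ∧
        π.map (fun ξ => g • ξ) ≪ π ∧
        π ≪ π.map (fun ξ => g • ξ) ∧
        (∀ ξ : MarkedConf.MConf X,
          {z ∈ ξ.1 | MarkedConf.groupDensity h ρ p g z ≠ 1}.Finite) ∧
        (π.map (fun ξ => g • ξ)).rnDeriv π =ᵐ[π]
          fun ξ => ∏ᶠ z ∈ ξ.1, MarkedConf.groupDensity h ρ p g z := by
  have hlc : LocallyCompactSpace X := ChartedSpace.locallyCompactSpace (MarkedConf.Eu d) X
  have hnt := MarkedConf.nontrivial_model d X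
  have hfib := MarkedConf.levyMeasure_fiber h ρ p
  obtain ⟨π₀, hπ₀⟩ := MarkedConf.exists_isMarkedPoisson hfib hfin
  refine ⟨⟨π₀, hπ₀, fun π hπ => hπ.unique hπ₀ hfib hfin⟩, fun π hπ g => ?_⟩
  have hmap := MarkedConf.map_levyMeasure hρ hp hρ_pos hp_pos hfin g
  obtain ⟨K, hK, hg, hg'⟩ := g.exists_compact_support
  have hu := MarkedConf.measurable_groupDensity (h := h) hρ hp g
  have hu_top := MarkedConf.groupDensity_ne_top (h := h) (ρ := ρ) (p := p) g
  have hu1 : ∀ z : X × MarkedConf.Mark, z.1 ∉ K → MarkedConf.groupDensity h ρ p g z = 1 :=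
    fun z hz => MarkedConf.groupDensity_eq_one g hK hg hg' hz
  have hu1' : ∀ z ∉ K ×ˢ (univ : Set MarkedConf.Mark), MarkedConf.groupDensity h ρ p g z = 1 :=
    fun z hz => hu1 z fun hzK => hz ⟨hzK, mem_univ _⟩
  have hKB := MarkedConf.relCompact_prod hK
  have hF := MarkedConf.measurable_finprod_mem (hK.measurableSet.prod .univ) hKB hu hu_top hu1'
  have key := hπ.map_smul hfin g hK hg hu hu_top hu1 hmap
  have := hπ.1
  refine ⟨hmap, MarkedConf.measurable_smul_mconf g, ?_, ?_, fun ξ => ?_, ?_⟩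
  · rw [key]
    exact withDensity_absolutelyContinuous _ _
  · rw [key]
    -- The density vanishes nowhere, so absolute continuity also holds in this direction.
    exact withDensity_absolutelyContinuous' hF.aemeasurable (.of_forall fun ξ =>
      MarkedConf.finprod_mem_ne_zero hKB (MarkedConf.groupDensity_ne_zero g) hu1' ξ)
  · exact (hKB.finite_inter ξ).subset fun z hz =>
      ⟨hz.1, by_contra fun hzK => hz.2 (hu1' z hzK)⟩
  · rw [key]
    exact Measure.rnDeriv_withDensity _ hF
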